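/- Consider the stochastic $k$-armed bandit with $k\ge 2$ arms and unit switching costs. An environment $\mathcal D=(\mathcal D_1,\dots,\mathcal D_k)$ consists of reward distributions on $\mathbb R$ with means $\mu_1,\dots,\mu_k$ that are standardized sub-Gaussian, i.e. $\mathbb E_{X\sim\mathcal D_i}[e^{s(X-\mu_i)}]\le e^{s^2/2}$ for all $s\in\mathbb R$, and satisfy $\max_{i,j}|\mu_i-\mu_j|\le 1$. A policy may be randomized, may depend on the horizon $T$, and chooses the action $\pi_t\in[k]$ of round $t$ from the actions and observed rewards of rounds $1,\dots,t-1$. It is an $S$-switch policy if, in every environment, the number of $t\in[T-1]$ with $\pi_t\ne\pi_{t+1}$ is at most $S$ with probability one. Its distribution-dependent regret is $R^\pi_{\mathcal D}(T)=T\max_i\mu_i-\mathbb E^\pi_{\mathcal D}\big[\sum_{t=1}^T\mu_{\pi_t}\big]$. For an optimal arm $i^*$ let $\Delta=\min_{i\ne i^*}|\mu_{i^*}-\mu_i|$. A family of policies (one for each horizon $T$) uniformly achieves $\tilde O(f(T)/\Delta)$ distribution-dependent regret if there are constants $C$ and $p\in\mathbb Z_{\ge0}$ such that $R^\pi_{\mathcal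 D}(T)\le C(\log T)^p f(T)/\Delta$ for all $T\ge2$ and all environments with $\Delta>0$. 1. For every integer $N\ge1$, $N(k-1)+1$ switches are necessary and sufficient for uniformly achieving $\tilde O(T^{1/(N+1)}/\Delta)$ distribution-dependent regret. That is: there is a family of $(N(k-1)+1)$-switch policies that uniformly achieves $\tilde O(T^{1/(N+1)}/\Delta)$; and if a family of $S_T$-switch policies uniformly achieves $\tilde O(T^{1/(N+1)}/\Delta)$, then $S_T\ge N(k-1)+1$ for all sufficiently large $T$. 2. $\Omega(\log T/\log\log T)$ switches are necessary for uniformly achieving $\tilde O(\log T/\Delta)$ distribution-dependent regret. That is: for every $p\in\mathbb Z_{\ge0}$ there is a constant $c>0$, depending only on $k$ and $p$, such that if a family of $S_T$-switch policies satisfies, for some constant $C$, $R^\pi_{\mathcal D}(T)\le C(\log T)^{p}\log T/\Delta$ for all $T\ge2$ and all environments with $\Delta>0$, then $S_T\ge c\,\log T/\log\log T$ for all sufficiently large $T$. -/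

import Mathlib

open MeasureTheory ProbabilityTheory Filter

noncomputable section

namespace Bandit

/-- A (randomized, non-anticipating) policy for the `k`-armed bandit: the action of round `t + 1` is
drawn from a probability kernel applied to the history of the first `t` rounds, i.e. to the pairs
(action, observed reward) of these rounds. -/
structure Policy (k : ℕ) where
  /-- the kernel that chooses the action after `t` observed rounds -/
  kernel : (t : ℕ) → Kernel (Fin t → Fin k × ℝ) (Fin k)
  isMarkov : ∀ t, IsMarkovKernel (kernel t)

/-- An environment: each arm has a reward distribution on `ℝ` which is standardized sub-Gaussian
(`E[exp (s (X - E X))] ≤ exp (s ^ 2 / 2)` for all real `s`), and the expected rewards of any two arms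
differ by at most `1`. -/
structure Environment (k : ℕ) where
  /-- the reward distribution of each arm -/
  dist : Fin k → Measure ℝ
  isProb : ∀ i, IsProbabilityMeasure (dist i)
  subGaussian : ∀ i, HasSubgaussianMGF (fun x => x - ∫ y, y ∂(dist i)) 1 (dist i)
  mean_sub_le : ∀ i j, |(∫ y, y ∂(dist i)) - ∫ y, y ∂(dist j)| ≤ 1

namespace Environment

variable {k : ℕ}

/-- The expected reward of arm `i`. -/
def mean (D : Environment k) (i : Fin k) : ℝ := ∫ y, y ∂(D.dist i)

/-- The largest expected reward. -/
def bestMean (D : Environment k) : ℝ := ⨆ i, D.mean i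

/-- Arm `i` has the largest expected reward. -/
def IsOptimal (D : Environment k) (i : Fin k) : Prop := ∀ j, D.mean j ≤ D.mean i

/-- The gap `min_{i ≠ o} |μ_o - μ_i|` between arm `o` and the other arms; used for an optimal `o`. -/
def gap (D : Environment k) (o : Fin k) : ℝ := ⨅ i : {i : Fin k // i ≠ o}, |D.mean o - D.mean i|

/-- The reward distributions as a kernel from arms to rewards. -/
def armKernel (D : Environment k) : Kernel (Fin k) ℝ := Kernel.ofFunOfCountable D.dist

instance (D : Environment k) : IsMarkovKernel D.armKernel := ⟨D.isProb⟩

end Environment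

namespace Policy

variable {k : ℕ}

instance (π : Policy k) (t : ℕ) : IsMarkovKernel (π.kernel t) := π.isMarkov t

/-- The law, under policy `π` and environment `D`, of the history of the first `t` rounds: given the
history of the first `t` rounds, the next action is drawn from the policy's kernel and then the reward
is drawn from the distribution of the chosen arm, independently of the past. -/
def historyLaw (π : Policy k) (D : Environment k) : (t : ℕ) → Measure (Fin t → Fin k × ℝ)
  | 0 => Measure.dirac Fin.elim0
  | t + 1 =>
    (historyLaw π D t ⊗ₘ (π.kernel t ⊗ₖ Kernel.prodMkLeft (Fin t → Fin k × ℝ) D.armKernel)).map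
      fun q => (Fin.snoc q.1 q.2 : Fin (t + 1) → Fin k × ℝ)

theorem measurable_snoc (t : ℕ) : Measurable fun q : (Fin t → Fin k × ℝ) × (Fin k × ℝ) =>
    (Fin.snoc q.1 q.2 : Fin (t + 1) → Fin k × ℝ) := by
  refine measurable_pi_lambda _ fun i => ?_
  induction i using Fin.lastCases with
  | last => simpa using measurable_snd
  | cast i =>
    simp only [Fin.snoc_castSucc]
    exact (measurable_pi_apply i).comp measurable_fst

instance (π : Policy k) (D : Environment k) (t : ℕ) :
    IsProbabilityMeasure (π.historyLaw D t) := by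
  induction t with
  | zero => unfold historyLaw; infer_instance
  | succ t ih =>
    unfold historyLaw
    exact Measure.isProbabilityMeasure_map (measurable_snoc t).aemeasurable

/-- The distribution-dependent regret `T μ* - E[∑_{t ≤ T} μ_{π_t}]` over `T` rounds. -/
def regret (π : Policy k) (D : Environment k) (T : ℕ) : ℝ :=
  T * D.bestMean - ∫ h, ∑ t, D.mean (h t).1 ∂(π.historyLaw D T)

end Policy

/-- The number of rounds `s < T` of a history such that the actions of rounds `s` and `s + 1`
differ. -/
def numSwitches {k T : ℕ} (h : Fin T → Fin k × ℝ) : ℕ :=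
  (Finset.univ.filter fun s : Fin T => ∃ t : Fin T, (t : ℕ) = s + 1 ∧ (h s).1 ≠ (h t).1).card

/-- `π` is an `S`-switch policy over `T` rounds: in every environment it makes at most `S` switches
with probability one. -/
def IsSwitchPolicy {k : ℕ} (π : Policy k) (T S : ℕ) : Prop :=
  ∀ D : Environment k, π.historyLaw D T {h | numSwitches h ≤ S} = 1

/-- The policies `π T` (one for each horizon `T`) have distribution-dependent regret at most
`C (log T) ^ p f(T) / Δ`, uniformly over all horizons `T ≥ 2` and all environments whose gap `Δ`
between the optimal arm and the best suboptimal arm is positive. -/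
def UniformRegretBound {k : ℕ} (π : ℕ → Policy k) (f : ℕ → ℝ) (C : ℝ) (p : ℕ) : Prop :=
  ∀ (D : Environment k) (o : Fin k), D.IsOptimal o → 0 < D.gap o →
    ∀ T : ℕ, 2 ≤ T → (π T).regret D T ≤ C * Real.log T ^ p * f T / D.gap o

/-- The policies `π T` uniformly achieve distribution-dependent regret `Õ(f(T) / Δ)`: constants and
powers of `log T` are hidden, and they do not depend on the environment. -/
def UniformlyAchieves {k : ℕ} (π : ℕ → Policy k) (f : ℕ → ℝ) : Prop :=
  ∃ (C : ℝ) (p : ℕ), UniformRegretBound π f C p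

end Bandit

end

/-! Necessity. In Gaussian environments, Cauchy–Schwarz bounds the squared probability of an event
under means `u` by `exp (δ m)` times its probability under means `v`, provided the event is settled
by the first `m` rounds or by any later play of an arm on which `u` and `v` differ
(`sq_historyLaw_gaussian_le`): as long as those arms are not played, later rounds carry no
information. So changes of means of order `1 / √m` are affordable.

Let `T ≥ b ^ N` and allow at most `N (k - 1)` switches. Cut the horizon at `b ^ j` for `j < N`. If,
with all means equal, some arm is likely to be left out of a block `[b ^ j, b ^ (j + 1))` before the
last, raising its mean by order `b ^ (-j / 2)` makes it optimal and yet often ignored. Otherwise all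
arms are often played in each of these `N - 1` blocks, which uses `(N - 1) (k - 1)` switches. Then
either some arm is left out of the last block, up to round `T / 2`, and is made optimal; or the arm
tried last there is reached with the budget exhausted, is played until `T`, and is made bad. Its
first play in the block settles that event, so the change of mean stays invisible. In every case
regret times gap is of order `b`, up to factors of `k` and `N`
(`exists_le_regret_mul_gap_of_isSwitchPolicy`). With `b` about `T ^ (1 / N)` this beats `T ^ (1 / (N
+ 1))`; with `N = S + 1` growing with `T` it gives the `log T / log log T` bound.

Sufficiency. Successive elimination with `N` stages, block lengths `b ^ (l + 1)` for `b` about `T ^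
(1 / (N + 1))`, and a final commitment. Sweeping the arms in alternating directions and giving the
blocks of eliminated arms to neighbours keeps the switches within `N (k - 1) + 1`
(`switchesIn_playedArm_le`). By sub-Gaussian concentration, an arm surviving a stage has regret per
round at most `(4 r) ^ 2 / Δ` for the confidence radius `r` of that stage, so each stage costs about
`b log T / Δ` (`regret_eliminationPolicy_le`). -/

open scoped ENNReal

namespace Bandit

/-! ### Second-moment comparison of measures -/

section CauchySchwarz

theorem sq_lintegral_mul_le {α : Type*} [MeasurableSpace α] (μ : Measure α) {f g : α → ℝ≥0∞}
    (hf : Measurable f) (hg : Measurable g) :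
    (∫⁻ x, f x * g x ∂μ) ^ 2 ≤ (∫⁻ x, f x ^ 2 ∂μ) * ∫⁻ x, g x ^ 2 ∂μ := by
  have h := ENNReal.lintegral_mul_le_Lp_mul_Lq μ Real.HolderConjugate.two_two
    hf.aemeasurable hg.aemeasurable
  have h2 := pow_le_pow_left' h 2
  simp only [Pi.mul_apply, ENNReal.rpow_two] at h2
  refine h2.trans_eq ?_
  rw [mul_pow, ← ENNReal.rpow_natCast, ← ENNReal.rpow_natCast, ← ENNReal.rpow_mul,
    ← ENNReal.rpow_mul]
  norm_num

/-- Randomness common to both laws (the policy's own draws, unchanged rewards) enters the comparison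
through this bound, at cost factor `1`. -/
theorem sq_lintegral_le {α : Type*} [MeasurableSpace α] (μ : Measure α) [IsProbabilityMeasure μ]
    {f : α → ℝ≥0∞} (hf : Measurable f) : (∫⁻ x, f x ∂μ) ^ 2 ≤ ∫⁻ x, f x ^ 2 ∂μ := by
  simpa using sq_lintegral_mul_le μ hf (measurable_const (a := (1 : ℝ≥0∞)))

/-- Shifting the mean of a unit-variance Gaussian costs a factor `exp (shift ^ 2)` in second
moments. -/
theorem sq_lintegral_gaussianReal_le (a b : ℝ) {g : ℝ → ℝ≥0∞} (hg : Measurable g) :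
    (∫⁻ x, g x ∂(gaussianReal a 1)) ^ 2 ≤
      ENNReal.ofReal (Real.exp ((a - b) ^ 2)) * ∫⁻ x, g x ^ 2 ∂(gaussianReal b 1) := by
  have hne : (1 : NNReal) ≠ 0 := one_ne_zero
  set w : ℝ → ℝ≥0∞ := fun x => ENNReal.ofReal (Real.exp ((a - b) * (x - b) - (a - b) ^ 2 / 2))
  have hw : Measurable w := by fun_prop
  have key : ∀ x, gaussianPDF a 1 x = gaussianPDF b 1 x * w x := by
    intro x
    simp only [gaussianPDF, w, gaussianPDFReal]
    rw [← ENNReal.ofReal_mul (by positivity), mul_assoc _ (Real.exp _) (Real.exp _),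
      ← Real.exp_add]
    congr 3
    simp only [NNReal.coe_one]
    ring
  have key2 : ∀ x, gaussianPDF b 1 x * w x ^ 2 =
      ENNReal.ofReal (Real.exp ((a - b) ^ 2)) * gaussianPDF (2 * a - b) 1 x := by
    intro x
    simp only [gaussianPDF, w, gaussianPDFReal]
    rw [← ENNReal.ofReal_pow (by positivity), ← ENNReal.ofReal_mul (by positivity),
      ← ENNReal.ofReal_mul (by positivity), ← Real.exp_nat_mul, mul_assoc, ← Real.exp_add,
      mul_left_comm, ← Real.exp_add]
    congr 3
    simp only [NNReal.coe_one]
    push_cast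
    ring
  have h1 : ∫⁻ x, g x ∂(gaussianReal a 1) = ∫⁻ x, g x * w x ∂(gaussianReal b 1) := by
    rw [gaussianReal_of_var_ne_zero _ hne, gaussianReal_of_var_ne_zero _ hne,
      lintegral_withDensity_eq_lintegral_mul _ (measurable_gaussianPDF _ _) hg,
      lintegral_withDensity_eq_lintegral_mul _ (measurable_gaussianPDF _ _)
        (show Measurable fun x => g x * w x from hg.mul hw)]
    refine lintegral_congr fun x => ?_
    simp only [Pi.mul_apply, key]
    ring
  have h2 : ∫⁻ x, w x ^ 2 ∂(gaussianReal b 1) = ENNReal.ofReal (Real.exp ((a - b) ^ 2)) := by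
    rw [gaussianReal_of_var_ne_zero _ hne,
      lintegral_withDensity_eq_lintegral_mul _ (measurable_gaussianPDF _ _) (hw.pow_const 2)]
    simp only [Pi.mul_apply, key2]
    rw [lintegral_const_mul _ (measurable_gaussianPDF _ _), lintegral_gaussianPDF_eq_one _ hne,
      mul_one]
  rw [h1, ← h2, mul_comm]
  exact sq_lintegral_mul_le _ hg hw

end CauchySchwarz

/-! ### Time-varying environments, chained comparison and stopped functions -/

noncomputable section

namespace Policy

variable {k : ℕ}

/-- The law of the history of the first `t` rounds when the environment changes over time. -/
def varyingLaw (π : Policy k) (E : ℕ → Environment k) : (t : ℕ) → Measure (Fin t → Fin k × ℝ)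
  | 0 => Measure.dirac Fin.elim0
  | t + 1 =>
    (varyingLaw π E t ⊗ₘ (π.kernel t ⊗ₖ
      Kernel.prodMkLeft (Fin t → Fin k × ℝ) (E t).armKernel)).map
      fun q => (Fin.snoc q.1 q.2 : Fin (t + 1) → Fin k × ℝ)

theorem varyingLaw_const (π : Policy k) (D : Environment k) (t : ℕ) :
    π.varyingLaw (fun _ => D) t = π.historyLaw D t := by
  induction t with
  | zero => rfl
  | succ t ih => rw [varyingLaw, historyLaw, ih]

instance (π : Policy k) (E : ℕ → Environment k) (t : ℕ) :
    IsProbabilityMeasure (π.varyingLaw E t) := by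
  induction t with
  | zero => unfold varyingLaw; infer_instance
  | succ t ih =>
    unfold varyingLaw
    exact Measure.isProbabilityMeasure_map (measurable_snoc t).aemeasurable

/-- The expectation of a function of the first `t + 1` rounds given the first `t` rounds. -/
def roundExp (π : Policy k) (D : Environment k) (t : ℕ) (f : (Fin (t + 1) → Fin k × ℝ) → ℝ≥0∞)
    (h : Fin t → Fin k × ℝ) : ℝ≥0∞ :=
  ∫⁻ a, ∫⁻ x, f (Fin.snoc h (a, x)) ∂(D.dist a) ∂(π.kernel t h)

instance (D : Environment k) (i : Fin k) : IsProbabilityMeasure (D.dist i) := D.isProb i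

theorem measurable_snoc_apply {t : ℕ} {f : (Fin (t + 1) → Fin k × ℝ) → ℝ≥0∞} (hf : Measurable f)
    (h : Fin t → Fin k × ℝ) :
    Measurable fun q : Fin k × ℝ => f (Fin.snoc h q) :=
  hf.comp ((measurable_snoc t).comp measurable_prodMk_left)

theorem roundExp_eq (π : Policy k) (D : Environment k) (t : ℕ)
    {f : (Fin (t + 1) → Fin k × ℝ) → ℝ≥0∞} (hf : Measurable f) (h : Fin t → Fin k × ℝ) :
    π.roundExp D t f h = ∫⁻ q, f (Fin.snoc h q)
      ∂((π.kernel t ⊗ₖ Kernel.prodMkLeft (Fin t → Fin k × ℝ) D.armKernel) h) := by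
  rw [Kernel.lintegral_compProd _ _ _ (measurable_snoc_apply hf h)]
  rfl

theorem measurable_roundExp (π : Policy k) (D : Environment k) (t : ℕ)
    {f : (Fin (t + 1) → Fin k × ℝ) → ℝ≥0∞} (hf : Measurable f) :
    Measurable (π.roundExp D t f) := by
  have : π.roundExp D t f = fun h => _ := funext fun h => roundExp_eq π D t hf h
  rw [this]
  exact (hf.comp (measurable_snoc t)).lintegral_kernel_prod_right'

theorem lintegral_varyingLaw_succ (π : Policy k) (E : ℕ → Environment k) (t : ℕ)
    {f : (Fin (t + 1) → Fin k × ℝ) → ℝ≥0∞} (hf : Measurable f) :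
    ∫⁻ h, f h ∂(π.varyingLaw E (t + 1)) =
      ∫⁻ h, π.roundExp (E t) t f h ∂(π.varyingLaw E t) := by
  rw [varyingLaw, lintegral_map hf (measurable_snoc t),
    Measure.lintegral_compProd (show Measurable fun q : (Fin t → Fin k × ℝ) × (Fin k × ℝ) =>
      f (Fin.snoc q.1 q.2) from hf.comp (measurable_snoc t))]
  exact lintegral_congr fun h => (roundExp_eq π (E t) t hf h).symm

theorem lintegral_historyLaw_succ (π : Policy k) (D : Environment k) (t : ℕ)
    {f : (Fin (t + 1) → Fin k × ℝ) → ℝ≥0∞} (hf : Measurable f) :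
    ∫⁻ h, f h ∂(π.historyLaw D (t + 1)) = ∫⁻ h, π.roundExp D t f h ∂(π.historyLaw D t) := by
  simpa only [varyingLaw_const] using lintegral_varyingLaw_succ π (fun _ => D) t hf

/-- Both laws draw the action from the same kernel, so only the reward contributes to the factor
`c`. -/
theorem sq_roundExp_le (π : Policy k) (D D' : Environment k) (t : ℕ) (c : ℝ≥0∞)
    (hc : ∀ (a : Fin k) (g : ℝ → ℝ≥0∞), Measurable g →
      (∫⁻ x, g x ∂(D.dist a)) ^ 2 ≤ c * ∫⁻ x, g x ^ 2 ∂(D'.dist a))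
    {f : (Fin (t + 1) → Fin k × ℝ) → ℝ≥0∞} (hf : Measurable f) (h : Fin t → Fin k × ℝ) :
    π.roundExp D t f h ^ 2 ≤ c * π.roundExp D' t (fun h => f h ^ 2) h := by
  refine (sq_lintegral_le _ Measurable.of_discrete).trans ?_
  rw [roundExp, ← lintegral_const_mul _ Measurable.of_discrete]
  exact lintegral_mono fun a => hc a _ ((measurable_snoc_apply hf h).comp measurable_prodMk_left)

/-- Comparison of two laws whose reward distributions are comparable in every round. -/
theorem sq_lintegral_varyingLaw_le (π : Policy k) (E E' : ℕ → Environment k) (c : ℕ → ℝ≥0∞)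
    (hc : ∀ (t : ℕ) (a : Fin k) (g : ℝ → ℝ≥0∞), Measurable g →
      (∫⁻ x, g x ∂((E t).dist a)) ^ 2 ≤ c t * ∫⁻ x, g x ^ 2 ∂((E' t).dist a)) (n : ℕ)
    {f : (Fin n → Fin k × ℝ) → ℝ≥0∞} (hf : Measurable f) :
    (∫⁻ h, f h ∂(π.varyingLaw E n)) ^ 2 ≤
      (∏ t ∈ Finset.range n, c t) * ∫⁻ h, f h ^ 2 ∂(π.varyingLaw E' n) := by
  induction n with
  | zero => simp [varyingLaw, lintegral_dirac' _ hf, lintegral_dirac' _ (hf.pow_const 2)]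
  | succ n ih =>
    rw [lintegral_varyingLaw_succ π E n hf, lintegral_varyingLaw_succ π E' n (hf.pow_const 2),
      Finset.prod_range_succ, mul_assoc]
    refine (ih (measurable_roundExp π _ n hf)).trans ?_
    gcongr
    rw [← lintegral_const_mul _ (measurable_roundExp π _ n (hf.pow_const 2))]
    exact lintegral_mono fun h => sq_roundExp_le π _ _ n _ (hc n) hf h

/-- A function of the history that, once an arm from `B` is chosen in a round `s ≥ m`, is determined
by the history before round `s` and the choice in round `s`. -/
def IsStopped (m : ℕ) (B : Set (Fin k)) {n : ℕ} (f : (Fin n → Fin k × ℝ) → ℝ≥0∞) : Prop :=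
  ∀ (s : Fin n) (h h' : Fin n → Fin k × ℝ), m ≤ s → (h s).1 ∈ B → (h s).1 = (h' s).1 →
    (∀ r < s, h r = h' r) → f h = f h'

/-- If an arm of `B` was played at an earlier round `s ≥ m`, then `f` is already constant in the
last round, and integrating that round out preserves this. It makes the backward induction on rounds
possible. -/
theorem IsStopped.roundExp {m : ℕ} {B : Set (Fin k)} {n : ℕ}
    {f : (Fin (n + 1) → Fin k × ℝ) → ℝ≥0∞} (hf : IsStopped m B f) (π : Policy k)
    (D : Environment k) : IsStopped m B (π.roundExp D n f) := by
  intro s h h' hms hB hs hr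
  have key : ∀ q q' : Fin k × ℝ, f (Fin.snoc h q) = f (Fin.snoc h' q') := by
    intro q q'
    refine hf s.castSucc _ _ (by simpa using hms) (by simpa using hB) (by simpa using hs) ?_
    intro r hrs
    have hrn : (r : ℕ) < n := lt_trans (by simpa [Fin.lt_def] using hrs) s.2
    have : r = Fin.castSucc ⟨r, hrn⟩ := rfl
    rw [this, Fin.snoc_castSucc (α := fun _ => Fin k × ℝ),
      Fin.snoc_castSucc (α := fun _ => Fin k × ℝ)]
    exact hr _ (by simpa [Fin.lt_def] using hrs)
  have hconst : ∀ g : Fin n → Fin k × ℝ, (∀ q, f (Fin.snoc g q) = f (Fin.snoc h' (h' s))) →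
      π.roundExp D n f g = f (Fin.snoc h' (h' s)) := by
    intro g hg
    simp [Policy.roundExp, hg]
  rw [hconst h fun q => key q _, hconst h' fun q => (key (h s) q).symm.trans (key _ _)]

/-- Environments that differ only in rounds `≥ m` and on arms of `B` give stopped functions the same
expectation. -/
theorem IsStopped.lintegral_varyingLaw_eq {m : ℕ} {B : Set (Fin k)} (π : Policy k)
    (E E' : ℕ → Environment k)
    (hE : ∀ t a, t < m ∨ a ∉ B → (E t).dist a = (E' t).dist a) {n : ℕ}
    {f : (Fin n → Fin k × ℝ) → ℝ≥0∞} (hf : IsStopped m B f) (hfm : Measurable f) :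
    ∫⁻ h, f h ∂(π.varyingLaw E n) = ∫⁻ h, f h ∂(π.varyingLaw E' n) := by
  induction n with
  | zero => rfl
  | succ n ih =>
    rw [lintegral_varyingLaw_succ π E n hfm, lintegral_varyingLaw_succ π E' n hfm,
      ih (hf.roundExp π _) (measurable_roundExp π _ n hfm)]
    refine lintegral_congr fun h => lintegral_congr fun a => ?_
    by_cases ha : n < m ∨ a ∉ B
    · rw [hE n a ha]
    · push Not at ha
      have key : ∀ x y : ℝ, f (Fin.snoc h (a, x)) = f (Fin.snoc h (a, y)) := by
        intro x y
        refine hf (Fin.last n) _ _ (by simpa using ha.1) (by simpa using ha.2) (by simp) ?_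
        intro r hr
        have : r = Fin.castSucc ⟨r, hr⟩ := rfl
        rw [this, Fin.snoc_castSucc (α := fun _ => Fin k × ℝ),
          Fin.snoc_castSucc (α := fun _ => Fin k × ℝ)]
      simp [key _ 0]

end Policy

end

end Bandit

/-! ### Gaussian environments, change of measure and regret -/

namespace Bandit

noncomputable section

variable {k : ℕ}

/-- The actions of a history, extended by `0` beyond the last round. -/
def act [NeZero k] {T : ℕ} (h : Fin T → Fin k × ℝ) (t : ℕ) : Fin k :=
  if ht : t < T then (h ⟨t, ht⟩).1 else 0

theorem act_val [NeZero k] {T : ℕ} (h : Fin T → Fin k × ℝ) (t : Fin T) : act h t = (h t).1 := by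
  simp [act]

theorem measurableSet_act [NeZero k] (T : ℕ) (p : (ℕ → Fin k) → Prop) :
    MeasurableSet {h : Fin T → Fin k × ℝ | p (act h)} := by
  have h1 : Measurable fun h : Fin T → Fin k × ℝ => fun t => (h t).1 := by fun_prop
  exact h1 (MeasurableSet.of_discrete
    (s := {a : Fin T → Fin k | p fun t => if ht : t < T then a ⟨t, ht⟩ else 0}))

namespace Environment

/-- The environment with unit-variance Gaussian rewards of the given means. -/
def gaussian (u : Fin k → ℝ) (hu : ∀ i j, |u i - u j| ≤ 1) : Environment k where
  dist i := gaussianReal (u i) 1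
  isProb i := inferInstance
  subGaussian i := by
    rw [integral_id_gaussianReal, ← HasSubgaussianMGF.id_map_iff (by fun_prop),
      gaussianReal_map_sub_const, sub_self]
    refine ⟨fun t => integrable_exp_mul_gaussianReal t, fun t => ?_⟩
    rw [mgf_id_gaussianReal]
    simp
  mean_sub_le i j := by simpa only [integral_id_gaussianReal] using hu i j

@[simp]
theorem mean_gaussian (u : Fin k → ℝ) (hu : ∀ i j, |u i - u j| ≤ 1) (i : Fin k) :
    (gaussian u hu).mean i = u i := integral_id_gaussianReal

theorem IsOptimal.bestMean_eq {D : Environment k} {o : Fin k} (ho : D.IsOptimal o) :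
    D.bestMean = D.mean o :=
  have : Nonempty (Fin k) := ⟨o⟩
  le_antisymm (ciSup_le ho) (le_ciSup (Set.finite_range D.mean).bddAbove o)

theorem IsOptimal.gap_le {D : Environment k} {o : Fin k} (ho : D.IsOptimal o) {i : Fin k}
    (hi : i ≠ o) : D.gap o ≤ D.mean o - D.mean i := by
  have := ciInf_le (Set.finite_range fun i : {i : Fin k // i ≠ o} =>
    |D.mean o - D.mean i|).bddBelow ⟨i, hi⟩
  rwa [abs_of_nonneg (sub_nonneg.2 (ho i))] at this

theorem le_gap (hk : 2 ≤ k) {D : Environment k} {o : Fin k} {ε : ℝ}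
    (h : ∀ i, i ≠ o → ε ≤ D.mean o - D.mean i) : ε ≤ D.gap o := by
  have : Nontrivial (Fin k) := Fin.nontrivial_iff_two_le.2 hk
  obtain ⟨i, hi⟩ := exists_ne o
  have : Nonempty {i : Fin k // i ≠ o} := ⟨⟨i, hi⟩⟩
  exact le_ciInf fun i => (h i i.2).trans (le_abs_self _)

end Environment

namespace Policy

open Environment

/-- The event `p` is determined by the actions up to any round `s ≥ m` that plays an arm of `B`. -/
def IsStoppedEvent (m : ℕ) (B : Set (Fin k)) (p : (ℕ → Fin k) → Prop) : Prop :=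
  ∀ (a a' : ℕ → Fin k) (s : ℕ), m ≤ s → a s ∈ B → (∀ r ≤ s, a r = a' r) → (p a → p a')

/-- Change of measure between two Gaussian environments that differ only on the arms of `B`. -/
theorem sq_historyLaw_gaussian_le [NeZero k] (π : Policy k) (u v : Fin k → ℝ)
    (hu : ∀ i j, |u i - u j| ≤ 1) (hv : ∀ i j, |v i - v j| ≤ 1) {δ : ℝ}
    (hδ : ∀ i, (u i - v i) ^ 2 ≤ δ) {B : Set (Fin k)} (hB : ∀ i ∉ B, u i = v i) (m T : ℕ)
    {p : (ℕ → Fin k) → Prop} (hp : IsStoppedEvent m B p) :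
    (π.historyLaw (gaussian u hu) T).real {h | p (act h)} ^ 2 ≤
      Real.exp (δ * m) * (π.historyLaw (gaussian v hv) T).real {h | p (act h)} := by
  classical
  have hδ0 : 0 ≤ δ := (sq_nonneg _).trans (hδ 0)
  set A : Set (Fin T → Fin k × ℝ) := {h | p (act h)}
  have hA : MeasurableSet A := measurableSet_act T p
  set f : (Fin T → Fin k × ℝ) → ℝ≥0∞ := A.indicator 1
  have hf : Measurable f := measurable_one.indicator hA
  have hfun : IsStopped m B f := by
    intro s h h' hs hsB hss hr
    have hact : ∀ r ≤ (s : ℕ), act h r = act h' r := by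
      intro r hrs
      have hrT : r < T := hrs.trans_lt s.2
      rcases hrs.lt_or_eq with hlt | heq
      · simp [act, hrT, hr ⟨r, hrT⟩ hlt]
      · subst heq
        rw [act_val, act_val, hss]
    have hiff : h ∈ A ↔ h' ∈ A :=
      ⟨hp _ _ s hs (by rwa [act_val]) hact,
        hp _ _ s hs (by rw [act_val, ← hss]; exact hsB) fun r hr => (hact r hr).symm⟩
    simp [f, Set.indicator, hiff]
  -- The hybrid has the means `u` for `m` rounds and `v` afterwards. It gives the stopped event the
  -- same probability as `u`, and differs from `v` in only `m` rounds.
  set Q : ℕ → Environment k := fun t => if t < m then gaussian u hu else gaussian v hv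
  have h1 : π.historyLaw (gaussian u hu) T A = π.varyingLaw Q T A := by
    rw [← varyingLaw_const, ← lintegral_indicator_one hA, ← lintegral_indicator_one hA]
    refine hfun.lintegral_varyingLaw_eq π _ Q (fun t a hta => ?_) hf
    by_cases ht : t < m
    · simp [Q, ht]
    · simp [Q, ht, gaussian, hB a (hta.resolve_left ht)]
  set c : ℕ → ℝ≥0∞ := fun t => if t < m then ENNReal.ofReal (Real.exp δ) else 1
  have h2 := sq_lintegral_varyingLaw_le π Q (fun _ => gaussian v hv) c (fun t a g hg => by
    by_cases ht : t < m
    · simp only [Q, c, ht, if_true]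
      refine (sq_lintegral_gaussianReal_le (u a) (v a) hg).trans ?_
      gcongr
      · exact hδ a
      · rfl
    · simp only [Q, c, ht, if_false, one_mul]
      exact sq_lintegral_le _ hg) T hf
  have hsq : ∀ h, f h ^ 2 = f h := by
    intro h
    by_cases hh : h ∈ A <;> simp [f, hh]
  have hc : ∏ t ∈ Finset.range T, c t ≤ ENNReal.ofReal (Real.exp (δ * m)) := by
    simp only [c]
    rw [Finset.prod_ite, Finset.prod_const, Finset.prod_const_one, mul_one,
      ← ENNReal.ofReal_pow (Real.exp_pos _).le, ← Real.exp_nat_mul, mul_comm δ]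
    gcongr
    calc _ ≤ (Finset.range m).card := Finset.card_le_card fun t => by simp
      _ = m := Finset.card_range m
  simp only [hsq, f, lintegral_indicator_one hA, varyingLaw_const] at h2
  rw [← h1] at h2
  have h3 := h2.trans (mul_le_mul_left hc _)
  have h4 := ENNReal.toReal_mono (ENNReal.mul_ne_top ENNReal.ofReal_ne_top
    (measure_ne_top _ _)) h3
  rwa [ENNReal.toReal_pow, ENNReal.toReal_mul, ENNReal.toReal_ofReal (Real.exp_pos _).le] at h4

theorem integrable_sum_act [NeZero k] (T : ℕ) (μ : Measure (Fin T → Fin k × ℝ))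
    [IsProbabilityMeasure μ] (g : Fin k → ℝ) :
    Integrable (fun h => ∑ t ∈ Finset.range T, g (act h t)) μ := by
  refine integrable_finsetSum _ fun t _ => Integrable.of_bound (C := ∑ i, ‖g i‖) ?_ ?_
  · have : Measurable fun h : Fin T → Fin k × ℝ => act h t := by
      refine measurable_to_countable' fun i => measurableSet_act T fun a => a t = i
    exact (Measurable.of_discrete.comp this).aestronglyMeasurable
  · exact ae_of_all _ fun h => Finset.single_le_sum (f := fun i => ‖g i‖)
      (fun i _ => norm_nonneg _) (Finset.mem_univ (act h t))

theorem regret_eq [NeZero k] (π : Policy k) {D : Environment k} {o : Fin k} (ho : D.IsOptimal o)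
    (T : ℕ) : π.regret D T =
      ∫ h, ∑ t ∈ Finset.range T, (D.mean o - D.mean (act h t)) ∂(π.historyLaw D T) := by
  have h1 : ∀ h : Fin T → Fin k × ℝ, ∑ t ∈ Finset.range T, (D.mean o - D.mean (act h t)) =
      T * D.mean o - ∑ t ∈ Finset.range T, D.mean (act h t) := by
    intro h
    simp [Finset.sum_sub_distrib]
  have h2 : ∀ h : Fin T → Fin k × ℝ,
      ∑ t, D.mean (h t).1 = ∑ t ∈ Finset.range T, D.mean (act h t) := by
    intro h
    rw [Finset.sum_range]
    simp [act_val]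
  simp only [h1]
  rw [integral_sub (integrable_const _) (integrable_sum_act T _ D.mean), regret, ho.bestMean_eq]
  simp [h2]

/-- On the event each round of `[m, M)` loses at least the gap; all other losses are nonnegative. -/
theorem le_regret [NeZero k] (π : Policy k) {D : Environment k} {o : Fin k} (ho : D.IsOptimal o)
    {T m M : ℕ} (hM : M ≤ T) {p : (ℕ → Fin k) → Prop}
    (hp : ∀ᵐ h ∂(π.historyLaw D T), p (act h) → ∀ t, m ≤ t → t < M → act h t ≠ o) :
    D.gap o * (M - m : ℕ) * (π.historyLaw D T).real {h | p (act h)} ≤ π.regret D T := by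
  have hA := measurableSet_act (k := k) T p
  rw [regret_eq π ho, mul_comm, ← smul_eq_mul, ← integral_indicator_const _ hA]
  refine integral_mono_ae ((integrable_const _).indicator hA)
    (integrable_sum_act T _ fun i => D.mean o - D.mean i) ?_
  filter_upwards [hp] with h hh
  have hnn : ∀ t, 0 ≤ D.mean o - D.mean (act h t) := fun t => sub_nonneg.2 (ho _)
  by_cases hph : p (act h)
  · rw [Set.indicator_of_mem (by exact hph)]
    calc D.gap o * (M - m : ℕ) = ∑ t ∈ Finset.Ico m M, D.gap o := by simp [mul_comm]
      _ ≤ ∑ t ∈ Finset.Ico m M, (D.mean o - D.mean (act h t)) := by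
        refine Finset.sum_le_sum fun t ht => ?_
        rw [Finset.mem_Ico] at ht
        exact ho.gap_le (hh hph t ht.1 ht.2)
      _ ≤ _ := by
        refine Finset.sum_le_sum_of_subset_of_nonneg (fun t ht => ?_) fun t _ _ => hnn t
        rw [Finset.mem_Ico] at ht
        exact Finset.mem_range.2 (ht.2.trans_le hM)
  · rw [Set.indicator_of_notMem (by exact hph)]
    exact Finset.sum_nonneg fun t _ => hnn t

end Policy

end

end Bandit

/-! ### Counting switches along an action sequence -/

namespace Bandit

noncomputable section

variable {k : ℕ}

section Switches

/-- The number of rounds `s ∈ [m, n)` such that the actions of rounds `s` and `s + 1` differ. -/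
def switchesIn (a : ℕ → Fin k) (m n : ℕ) : ℕ :=
  ((Finset.Ico m n).filter fun s => a s ≠ a (s + 1)).card

theorem switchesIn_add (a : ℕ → Fin k) {l m n : ℕ} (hlm : l ≤ m) (hmn : m ≤ n) :
    switchesIn a l m + switchesIn a m n = switchesIn a l n := by
  rw [switchesIn, switchesIn, switchesIn, ← Finset.card_union_of_disjoint, ← Finset.filter_union,
    Finset.Ico_union_Ico_eq_Ico hlm hmn]
  exact Finset.disjoint_filter_filter (Finset.Ico_disjoint_Ico_consecutive l m n)

theorem switchesIn_mono (a : ℕ → Fin k) (l : ℕ) {m n : ℕ} (hmn : m ≤ n) :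
    switchesIn a l m ≤ switchesIn a l n :=
  Finset.card_le_card (Finset.filter_subset_filter _ (Finset.Ico_subset_Ico_right hmn))

theorem switchesIn_succ (a : ℕ → Fin k) (n : ℕ) :
    switchesIn a n (n + 1) = if a n ≠ a (n + 1) then 1 else 0 := by
  simp only [switchesIn, Nat.Ico_succ_singleton, Finset.filter_singleton]
  split_ifs <;> simp

theorem switchesIn_congr {a a' : ℕ → Fin k} {m n : ℕ} (h : ∀ r ≤ n, a r = a' r) :
    switchesIn a m n = switchesIn a' m n := by
  unfold switchesIn
  congr 1
  refine Finset.filter_congr fun s hs => ?_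
  rw [Finset.mem_Ico] at hs
  rw [h s hs.2.le, h (s + 1) hs.2]

theorem numSwitches_eq [NeZero k] {T : ℕ} (h : Fin T → Fin k × ℝ) :
    numSwitches h = switchesIn (act h) 0 (T - 1) := by
  refine Finset.card_bij (fun s _ => (s : ℕ)) ?_ (fun _ _ _ _ h => Fin.ext h) ?_
  · intro s hs
    obtain ⟨t, hts, hne⟩ := (Finset.mem_filter.1 hs).2
    rw [Finset.mem_filter, Finset.mem_Ico, ← hts, act_val, act_val]
    exact ⟨⟨Nat.zero_le _, by omega⟩, hne⟩
  · intro s hs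
    rw [Finset.mem_filter, Finset.mem_Ico] at hs
    have h1 : s + 1 < T := by omega
    refine ⟨⟨s, by omega⟩, Finset.mem_filter.2 ⟨Finset.mem_univ _, ⟨s + 1, h1⟩, rfl, ?_⟩, rfl⟩
    rw [← act_val, ← act_val]
    exact hs.2

/-- A new arm can only appear through a switch. -/
theorem card_image_le_switchesIn (a : ℕ → Fin k) {m n : ℕ} (hmn : m ≤ n) :
    ((Finset.Icc m n).image a).card ≤ switchesIn a m n + 1 := by
  induction n, hmn using Nat.le_induction with
  | base => simp
  | succ n hmn ih =>
    rw [← switchesIn_add a hmn (Nat.le_succ n), switchesIn_succ,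
      ← Finset.insert_Icc_right_eq_Icc_add_one (by omega), Finset.image_insert]
    split_ifs with hne
    · exact (Finset.card_insert_le _ _).trans (by omega)
    · rw [Finset.insert_eq_of_mem]
      · omega
      · push Not at hne
        rw [← hne]
        exact Finset.mem_image_of_mem _ (Finset.mem_Icc.2 ⟨hmn, le_rfl⟩)

theorem le_switchesIn_of_forall_exists (a : ℕ → Fin k) {m n : ℕ} (hmn : m ≤ n)
    (h : ∀ i, ∃ t, m ≤ t ∧ t ≤ n ∧ a t = i) : k - 1 ≤ switchesIn a m n := by
  have h1 : (Finset.Icc m n).image a = Finset.univ := by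
    refine Finset.eq_univ_of_forall fun i => ?_
    obtain ⟨t, h1, h2, rfl⟩ := h i
    exact Finset.mem_image_of_mem _ (Finset.mem_Icc.2 ⟨h1, h2⟩)
  have h2 := card_image_le_switchesIn a hmn
  rw [h1, Finset.card_univ, Fintype.card_fin] at h2
  omega

theorem mul_le_switchesIn (a : ℕ → Fin k) {g : ℕ → ℕ} (hg : Monotone g) (J : ℕ)
    (h : ∀ j < J, ∀ i, ∃ t, g j ≤ t ∧ t < g (j + 1) ∧ a t = i) :
    J * (k - 1) ≤ switchesIn a 0 (g J) := by
  induction J with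
  | zero => simp
  | succ J ih =>
    have h1 := ih fun j hj => h j (by omega)
    have h2 := le_switchesIn_of_forall_exists a (hg (Nat.le_succ J)) fun i => by
      obtain ⟨t, h1, h2, h3⟩ := h J (by omega) i
      exact ⟨t, h1, h2.le, h3⟩
    rw [← switchesIn_add a (Nat.zero_le _) (hg (Nat.le_succ J)), Nat.succ_mul]
    omega

/-- Arm `i` is not played in the rounds of `[m, M)`. -/
def Avoids (m M : ℕ) (i : Fin k) (a : ℕ → Fin k) : Prop := ∀ t, m ≤ t → t < M → a t ≠ i

/-- When arm `i` is first played after round `m`, which happens before round `M`, at least `S`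
switches have been made. -/
def Commits (m M S : ℕ) (i : Fin k) (a : ℕ → Fin k) : Prop :=
  ∃ s, m ≤ s ∧ s < M ∧ a s = i ∧ Avoids m s i a ∧ S ≤ switchesIn a 0 s

/-- If no arm is left out, take the first round `s` by which all arms have been played since `m`.
The arm of round `s` is new, and visiting all `k` arms took `k - 1` switches. -/
theorem exists_avoids_or_commits (hk : 2 ≤ k) (a : ℕ → Fin k) {m M S : ℕ}
    (hS : S ≤ switchesIn a 0 m) : ∃ i, Avoids m M i a ∨ Commits m M (S + (k - 1)) i a := by
  by_contra! hcon
  have hall : ∀ i, ∃ t, m ≤ t ∧ t < M ∧ a t = i := by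
    intro i
    have := (hcon i).1
    unfold Avoids at this
    push Not at this
    exact this
  have hmM : m < M := by
    obtain ⟨t, h1, h2, -⟩ := hall ⟨0, by omega⟩
    omega
  classical
  have hex : ∃ n, m ≤ n ∧ n < M ∧ ∀ i, ∃ t, m ≤ t ∧ t ≤ n ∧ a t = i := by
    refine ⟨M - 1, by omega, by omega, fun i => ?_⟩
    obtain ⟨t, h1, h2, h3⟩ := hall i
    exact ⟨t, h1, by omega, h3⟩
  obtain ⟨hms, hsM, hs⟩ := Nat.find_spec hex
  set s := Nat.find hex
  have hcount : S + (k - 1) ≤ switchesIn a 0 s := by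
    rw [← switchesIn_add a (Nat.zero_le m) hms]
    exact add_le_add hS (le_switchesIn_of_forall_exists a hms hs)
  obtain ⟨i, hi⟩ : ∃ i, Avoids m s i a := by
    rcases hms.eq_or_lt with heq | hlt
    · exact ⟨a s, fun t h1 h2 => absurd h1 (by omega)⟩
    · have := Nat.find_min hex (show s - 1 < s by omega)
      by_contra! hno
      refine this ⟨by omega, by omega, fun i => ?_⟩
      have hi := hno i
      unfold Avoids at hi
      push Not at hi
      obtain ⟨t, h1, h2, h3⟩ := hi
      exact ⟨t, h1, by omega, h3⟩
  obtain ⟨t, h1, h2, h3⟩ := hs i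
  have hts : t = s := by
    by_contra hne
    exact hi t h1 (by omega) h3
  exact (hcon i).2 ⟨s, hms, hsM, hts ▸ h3, hi, hcount⟩

/-- The switch budget is used up when `i` is reached, so `i` can no longer be left. -/
theorem Commits.eq_of_le {m M S T : ℕ} {i : Fin k} {a : ℕ → Fin k} (h : Commits m M S i a)
    (hS : switchesIn a 0 (T - 1) ≤ S) {t : ℕ} (ht : M ≤ t) (htT : t < T) : a t = i := by
  obtain ⟨s, -, hsM, rfl, -, hs⟩ := h
  have hst : s ≤ t := by omega
  clear ht
  induction t, hst using Nat.le_induction with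
  | base => rfl
  | succ t hst ih =>
    rw [← ih (by omega)]
    by_contra hne
    have h1 := switchesIn_add a (Nat.zero_le s) hst
    have h2 := switchesIn_add a (Nat.zero_le t) (show t ≤ t + 1 by omega)
    have h3 := switchesIn_mono a 0 (show t + 1 ≤ T - 1 by omega)
    rw [switchesIn_succ, if_pos (Ne.symm hne)] at h2
    omega

end Switches

namespace Policy

/-- A play of `i` inside `[m, M)` refutes the event; a play at or after `M` comes when it is already
decided. -/
theorem isStoppedEvent_avoids (m M : ℕ) (i : Fin k) :
    IsStoppedEvent m {i} (Avoids m M i) := by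
  intro a a' s hs hi hr h t h1 h2
  by_cases hts : t ≤ s
  · rw [← hr t hts]
    exact h t h1 h2
  · exact absurd hi (h s hs (by omega))

/-- The first play of `i` from round `m` on decides the event, as the switch count refers to the
rounds up to it; rewards of `i` after round `m` are therefore irrelevant. -/
theorem isStoppedEvent_commits (m M S : ℕ) (i : Fin k) :
    IsStoppedEvent m {i} (Commits m M S i) := by
  rintro a a' s hs hi hr ⟨t, h1, h2, h3, h4, h5⟩
  have hts : t ≤ s := by
    by_contra hlt
    exact h4 s hs (by omega) hi
  refine ⟨t, h1, h2, by rw [← hr t hts]; exact h3, fun r h6 h7 => ?_, ?_⟩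
  · rw [← hr r (by omega)]
    exact h4 r h6 h7
  · rwa [← switchesIn_congr fun r hrt => hr r (hrt.trans hts)]

theorem IsStoppedEvent.of_forall {m : ℕ} {p : (ℕ → Fin k) → Prop}
    (h : ∀ a a' : ℕ → Fin k, (∀ r < m, a r = a' r) → p a → p a') (B : Set (Fin k)) :
    IsStoppedEvent m B p :=
  fun a a' _ hs _ hr => h a a' fun r hrm => hr r (by omega)

end Policy

theorem IsSwitchPolicy.ae_le [NeZero k] {π : Policy k} {T S : ℕ} (h : IsSwitchPolicy π T S)
    (D : Environment k) : ∀ᵐ x ∂(π.historyLaw D T), switchesIn (act x) 0 (T - 1) ≤ S := by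
  have hm := measurableSet_act (k := k) T fun a => switchesIn a 0 (T - 1) ≤ S
  refine (mem_ae_iff_prob_eq_one hm).2 ?_
  simpa only [numSwitches_eq] using h D

end

end Bandit

/-! ### Regret lower bound under a switching budget -/

namespace Bandit

noncomputable section

variable {k : ℕ}

open Environment Policy

/-- If the actions of an event, which has probability `q` under one Gaussian environment, are bad
under a slightly different one, then the regret there is large. -/
theorem Policy.exists_le_regret_mul_gap [NeZero k] (hk : 2 ≤ k) (π : Policy k) {u v : Fin k → ℝ}
    (hu : ∀ i j, |u i - u j| ≤ 1) (hv : ∀ i j, |v i - v j| ≤ 1) {δ ε q : ℝ} (hε : 0 < ε)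
    (hq0 : 0 ≤ q) (hδ : ∀ i, (u i - v i) ^ 2 ≤ δ) {B : Set (Fin k)} (hB : ∀ i ∉ B, u i = v i)
    {m m' M T : ℕ} (hM : M ≤ T) (hδm : δ * m ≤ 1) {p : (ℕ → Fin k) → Prop}
    (hp : IsStoppedEvent m B p)
    (hq : q ≤ (π.historyLaw (gaussian u hu) T).real {h | p (act h)}) (o : Fin k)
    (ho : ∀ j, j ≠ o → ε ≤ v o - v j)
    (hpo : ∀ᵐ h ∂(π.historyLaw (gaussian v hv) T),
      p (act h) → ∀ t, m' ≤ t → t < M → act h t ≠ o) :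
    ∃ (D : Environment k) (o : Fin k), D.IsOptimal o ∧ 0 < D.gap o ∧
      ε ^ 2 * (M - m' : ℕ) * (q ^ 2 / 3) ≤ π.regret D T * D.gap o := by
  set D := gaussian v hv
  have hopt : D.IsOptimal o := by
    intro j
    rw [mean_gaussian, mean_gaussian]
    rcases eq_or_ne j o with rfl | hj
    · rfl
    · linarith [ho j hj]
  have hgap : ε ≤ D.gap o := le_gap hk fun i hi => by
    rw [mean_gaussian, mean_gaussian]
    exact ho i hi
  refine ⟨D, o, hopt, hε.trans_le hgap, ?_⟩
  have h1 := sq_historyLaw_gaussian_le π u v hu hv hδ hB m T hp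
  have h2 := le_regret π hopt hM hpo
  set P := (π.historyLaw D T).real {h | p (act h)}
  have hP : 0 ≤ P := measureReal_nonneg
  have h3 : q ^ 2 / 3 ≤ P := by
    -- The total cost of the change of measure is at most `e`.
    have h4 : Real.exp (δ * m) ≤ 3 :=
      (Real.exp_le_exp.2 hδm).trans (Real.exp_one_lt_d9.le.trans (by norm_num))
    have h5 : q ^ 2 ≤ Real.exp (δ * m) * P := (pow_le_pow_left₀ hq0 hq 2).trans h1
    have h6 := mul_le_mul_of_nonneg_right h4 hP
    linarith
  calc ε ^ 2 * (M - m' : ℕ) * (q ^ 2 / 3) ≤ D.gap o ^ 2 * (M - m' : ℕ) * P := by gcongr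
    _ = (D.gap o * (M - m' : ℕ) * P) * D.gap o := by ring
    _ ≤ _ := mul_le_mul_of_nonneg_right h2 (hε.le.trans hgap)

/-- With `ε = 1 / (3 √m)`, changing means by up to `3 ε` costs at most a factor `e` over `m` rounds,
and means in `[0, 3 ε]` are admissible. -/
theorem exists_scale {m : ℕ} (hm : 1 ≤ m) : ∃ ε : ℝ, 0 < ε ∧ 9 * ε ^ 2 * m = 1 ∧ 3 * ε ≤ 1 := by
  have hm' : (1 : ℝ) ≤ m := by exact_mod_cast hm
  refine ⟨1 / (3 * √m), by positivity, ?_, ?_⟩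
  · rw [div_pow, mul_pow, Real.sq_sqrt (by positivity)]
    field_simp
    norm_num
  · have : 1 ≤ √(m : ℝ) := Real.one_le_sqrt.2 hm'
    rw [mul_one_div, div_le_one (by positivity)]
    linarith

/-- Before the last block, either some arm is left out in some block, or the last block has to
commit. -/
theorem Policy.le_of_avoids_grid [NeZero k] (π : Policy k) (D : Environment k) (T J : ℕ)
    (g : ℕ → ℕ) {q : ℝ} (hq : J * k * q ≤ 1 / 2)
    (h : ∀ j < J, ∀ i : Fin k,
      (π.historyLaw D T).real {h | Avoids (g j) (g (j + 1)) i (act h)} ≤ q) :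
    1 / 2 ≤ (π.historyLaw D T).real
      {h | ∀ j < J, ∀ i : Fin k, ¬ Avoids (g j) (g (j + 1)) i (act h)} := by
  have hm := measurableSet_act (k := k) T fun a => ∀ j < J, ∀ i, ¬ Avoids (g j) (g (j + 1)) i a
  set F := {h : Fin T → Fin k × ℝ | ∀ j < J, ∀ i : Fin k, ¬ Avoids (g j) (g (j + 1)) i (act h)}
  have h1 : Fᶜ ⊆ ⋃ x ∈ Finset.range J ×ˢ (Finset.univ : Finset (Fin k)),
      {h : Fin T → Fin k × ℝ | Avoids (g x.1) (g (x.1 + 1)) x.2 (act h)} := by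
    intro x hx
    simp only [F, Set.mem_compl_iff, Set.mem_ofPred_eq, not_forall, not_not] at hx
    obtain ⟨j, hj, i, hi⟩ := hx
    simp only [Set.mem_iUnion, Finset.mem_product, Finset.mem_range, Finset.mem_univ]
    exact ⟨(j, i), ⟨hj, trivial⟩, hi⟩
  have h2 : (π.historyLaw D T).real Fᶜ ≤ J * k * q := by
    refine (measureReal_mono h1 (measure_ne_top _ _)).trans
      ((measureReal_biUnion_finset_le _ _).trans ?_)
    refine (Finset.sum_le_card_nsmul _ _ q fun x hx => ?_).trans ?_
    · exact h x.1 (Finset.mem_range.1 (Finset.mem_product.1 hx).1) x.2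
    · simp [Finset.card_product]
  rw [probReal_compl_eq_one_sub hm] at h2
  linarith

/-- Pigeonhole over the `2 k` events of `exists_avoids_or_commits`; full sweeps of the `J` earlier
blocks supply the initial `J (k - 1)` switches. -/
theorem Policy.exists_avoids_or_commits_le [NeZero k] (hk : 2 ≤ k) (π : Policy k)
    (D : Environment k) {T J M : ℕ} {g : ℕ → ℕ} (hg : Monotone g) {q : ℝ}
    (hq : k * (2 * q) < (π.historyLaw D T).real
      {h | ∀ j < J, ∀ i : Fin k, ¬ Avoids (g j) (g (j + 1)) i (act h)}) :
    ∃ i : Fin k, q ≤ (π.historyLaw D T).real {h | Avoids (g J) M i (act h)} ∨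
      q ≤ (π.historyLaw D T).real
        {h | Commits (g J) M (J * (k - 1) + (k - 1)) i (act h)} := by
  by_contra! hcon
  refine hq.not_ge ?_
  have h1 : {h : Fin T → Fin k × ℝ | ∀ j < J, ∀ i : Fin k, ¬ Avoids (g j) (g (j + 1)) i (act h)} ⊆
      ⋃ i ∈ (Finset.univ : Finset (Fin k)), ({h : Fin T → Fin k × ℝ | Avoids (g J) M i (act h)} ∪
        {h | Commits (g J) M (J * (k - 1) + (k - 1)) i (act h)}) := by
    intro x hx
    have hsw := mul_le_switchesIn (act x) hg J fun j hj i => by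
      have := hx j hj i
      unfold Avoids at this
      push Not at this
      exact this
    obtain ⟨i, hi⟩ := exists_avoids_or_commits (M := M) hk (act x) hsw
    simp only [Set.mem_iUnion, Finset.mem_univ]
    exact ⟨i, trivial, hi⟩
  refine (measureReal_mono h1 (measure_ne_top _ _)).trans
    ((measureReal_biUnion_finset_le _ _).trans ?_)
  refine (Finset.sum_le_card_nsmul _ _ (2 * q) fun i _ => ?_).trans (by simp)
  refine (measureReal_union_le _ _).trans ?_
  linarith [(hcon i).1, (hcon i).2]

theorem abs_sub_le_one_of_mem {u : Fin k → ℝ} {c : ℝ} (hc : c ≤ 1)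
    (h : ∀ i, 0 ≤ u i ∧ u i ≤ c) (i j : Fin k) : |u i - u j| ≤ 1 := by
  rw [abs_le]
  constructor <;> linarith [(h i).1, (h i).2, (h j).1, (h j).2]

/-- A policy with at most `N (k - 1)` switches has regret of order `T ^ (1 / N) / Δ` in some
environment. -/
theorem Policy.exists_le_regret_mul_gap_of_isSwitchPolicy (hk : 2 ≤ k) (π : Policy k)
    {T S N b : ℕ} (hN : 1 ≤ N) (hS : S ≤ N * (k - 1)) (hπ : IsSwitchPolicy π T S) (hb : 8 ≤ b)
    (hT : b ^ N ≤ T) :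
    ∃ (D : Environment k) (o : Fin k), D.IsOptimal o ∧ 0 < D.gap o ∧
      (b : ℝ) / (67500 * k ^ 2 * N ^ 2) ≤ π.regret D T * D.gap o := by
  have : NeZero k := ⟨by omega⟩
  obtain ⟨J, rfl⟩ : ∃ J, N = J + 1 := ⟨N - 1, by omega⟩
  have hk0 : (0 : ℝ) < k := by exact_mod_cast (show 0 < k by omega)
  have hb8 : (8 : ℝ) ≤ b := by exact_mod_cast hb
  have hN1 : (1 : ℝ) ≤ ((J + 1 : ℕ) : ℝ) := by exact_mod_cast hN
  have hu0 : ∀ i j : Fin k, |(0 : Fin k → ℝ) i - (0 : Fin k → ℝ) j| ≤ 1 := by simp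
  set g : ℕ → ℕ := fun j => b ^ j
  have hg : Monotone g := fun i j hij => Nat.pow_le_pow_right (by omega) hij
  set q : ℝ := 1 / (2 * ((J + 1 : ℕ) : ℝ) * k)
  -- The value of `q` lets a union bound over `J` blocks and `k` arms keep probability `1 / 2` for
  -- playing every arm in every block.
  by_cases hcase : ∀ j < J, ∀ i : Fin k,
      (π.historyLaw (gaussian 0 hu0) T).real {h | Avoids (g j) (g (j + 1)) i (act h)} ≤ q
  · have hF := π.le_of_avoids_grid _ T J g (q := q) (by
      simp only [q]
      push_cast
      rw [mul_one_div, div_le_div_iff₀ (by positivity) (by positivity)]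
      nlinarith) hcase
    obtain ⟨ε, hε, hεm, hε1⟩ := exists_scale (m := b ^ J) (Nat.one_le_pow _ _ (by omega))
    have hδ : 9 * ε ^ 2 * ((b ^ J : ℕ) : ℝ) ≤ 1 := hεm.le
    set i₀ : Fin k := ⟨0, by omega⟩
    set i₁ : Fin k := ⟨1, by omega⟩
    have hi₁ : i₁ ≠ i₀ := by simp [i₀, i₁]
    -- Raising any one arm to `3 ε` makes it best by at least `ε`; lowering any one arm to `0`
    -- leaves another arm best by at least `ε`.
    set ν : Fin k → ℝ := fun i => if i = i₀ then 2 * ε else if i = i₁ then ε else 0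
    have hν : ∀ i, 0 ≤ ν i ∧ ν i ≤ 2 * ε := by
      intro i
      simp only [ν]
      split_ifs <;> constructor <;> linarith
    have hν1 := abs_sub_le_one_of_mem (show 2 * ε ≤ 1 by linarith) hν
    -- The event concerns rounds before `b ^ J` only, so `(1 / 2) ^ 2 ≤ 3 P`.
    have hFν : 1 / 12 ≤ (π.historyLaw (gaussian ν hν1) T).real
        {h | ∀ j < J, ∀ i : Fin k, ¬ Avoids (g j) (g (j + 1)) i (act h)} := by
      have h1 := sq_historyLaw_gaussian_le π 0 ν hu0 hν1 (δ := 9 * ε ^ 2)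
        (fun i => by
          simp only [Pi.zero_apply, zero_sub]
          nlinarith [hν i]) (B := Set.univ) (by simp) (b ^ J) T
        (p := fun a => ∀ j < J, ∀ i : Fin k, ¬ Avoids (g j) (g (j + 1)) i a)
        (IsStoppedEvent.of_forall (fun a a' haa ha j hj i hav => ha j hj i fun t h1 h2 => by
          rw [haa t (h2.trans_le (hg (show j + 1 ≤ J by omega)))]
          exact hav t h1 h2) _)
      have h4 : Real.exp (9 * ε ^ 2 * ((b ^ J : ℕ) : ℝ)) ≤ 3 :=
        (Real.exp_le_exp.2 hδ).trans (Real.exp_one_lt_d9.le.trans (by norm_num))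
      have h5 := mul_le_mul_of_nonneg_right h4 (measureReal_nonneg
        (μ := π.historyLaw (gaussian ν hν1) T)
        (s := {h | ∀ j < J, ∀ i : Fin k, ¬ Avoids (g j) (g (j + 1)) i (act h)}))
      have h6 := pow_le_pow_left₀ (by norm_num) hF 2
      linarith
    -- Here `2 k q = 2 / 25 < 1 / 12`. Ending the block at `T / 2` leaves half of the horizon for
    -- the loss after a commitment.
    obtain ⟨i, hi⟩ := π.exists_avoids_or_commits_le hk (gaussian ν hν1) (T := T) (M := T / 2) hg
      (q := 1 / (25 * k)) (lt_of_lt_of_le (by field_simp; norm_num) hFν)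
    have hTb : ((b ^ J : ℕ) : ℝ) * b ≤ T := by exact_mod_cast hT
    have hbJ : (1 : ℝ) ≤ ((b ^ J : ℕ) : ℝ) := by exact_mod_cast Nat.one_le_pow _ _ (by omega)
    have hT2 : (T : ℝ) / 2 - 1 / 2 ≤ ((T / 2 : ℕ) : ℝ) := by
      have : T ≤ 2 * (T / 2) + 1 := by omega
      have : (T : ℝ) ≤ 2 * ((T / 2 : ℕ) : ℝ) + 1 := by exact_mod_cast this
      linarith
    have hT3 : ((T / 2 : ℕ) : ℝ) ≤ T / 2 := Nat.cast_div_le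
    -- `ε ^ 2 T / 4 ≥ b / 36`, and `67500 = 36 * 25 ^ 2 * 3`.
    have hfin : ∀ n : ℕ, (T : ℝ) / 4 ≤ n →
        (b : ℝ) / (67500 * k ^ 2 * ((J + 1 : ℕ) : ℝ) ^ 2) ≤ ε ^ 2 * n * ((1 / (25 * k)) ^ 2 / 3) := by
      intro n hn
      have h1 : (b : ℝ) / 36 ≤ ε ^ 2 * n := by
        calc (b : ℝ) / 36 = (9 * ε ^ 2 * ((b ^ J : ℕ) : ℝ)) * b / 36 := by rw [hεm, one_mul]
          _ = ε ^ 2 * ((((b ^ J : ℕ) : ℝ) * b) / 4) := by ring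
          _ ≤ ε ^ 2 * n := by gcongr; linarith
      calc (b : ℝ) / (67500 * k ^ 2 * ((J + 1 : ℕ) : ℝ) ^ 2) ≤ (b : ℝ) / (67500 * k ^ 2 * 1 ^ 2) := by
            gcongr
        _ ≤ (b : ℝ) / 36 * ((1 / (25 * k)) ^ 2 / 3) := by
          rw [div_mul_eq_mul_div, div_le_div_iff₀ (by positivity) (by positivity)]
          field_simp
          norm_num
        _ ≤ _ := by gcongr
    rcases hi with hi | hi
    -- The neglected arm is made optimal.
    · have hvi : ∀ l, 0 ≤ Function.update ν i (3 * ε) l ∧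
          Function.update ν i (3 * ε) l ≤ 3 * ε := by
        intro l
        rcases eq_or_ne l i with rfl | hl
        · simp [hε.le]
        · simp only [Function.update_of_ne hl]
          exact ⟨(hν l).1, by linarith [(hν l).2]⟩
      obtain ⟨D, o, h1, h2, h3⟩ := π.exists_le_regret_mul_gap hk hν1
        (abs_sub_le_one_of_mem hε1 hvi) (δ := 9 * ε ^ 2) hε (by positivity)
        (fun l => by
          rcases eq_or_ne l i with rfl | hl
          · rw [Function.update_self]
            nlinarith [hν l]
          · rw [Function.update_of_ne hl, sub_self]
            nlinarith [sq_nonneg ε])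
        (B := {i}) (m' := g J)
        (fun l hl => (Function.update_of_ne (by simpa using hl) _ _).symm)
        (Nat.div_le_self T 2) hδ (isStoppedEvent_avoids (g J) (T / 2) i) hi i
        (fun l hl => by
          rw [Function.update_self, Function.update_of_ne hl]
          linarith [(hν l).2]) (ae_of_all _ fun h hh => hh)
      refine ⟨D, o, h1, h2, (hfin _ ?_).trans h3⟩
      have h4 : ((T / 2 : ℕ) : ℝ) ≤ ((T / 2 - g J : ℕ) : ℝ) + ((b ^ J : ℕ) : ℝ) := by
        have : T / 2 ≤ T / 2 - g J + b ^ J := by simp only [g]; omega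
        exact_mod_cast this
      nlinarith
    -- The arm committed to is made suboptimal; it is then played throughout `[T / 2, T)`.
    · have hvi : ∀ l, 0 ≤ Function.update ν i 0 l ∧ Function.update ν i 0 l ≤ 2 * ε := by
        intro l
        rcases eq_or_ne l i with rfl | hl
        · simp [hε.le]
        · simp only [Function.update_of_ne hl]
          exact hν l
      have hvi1 := abs_sub_le_one_of_mem (show 2 * ε ≤ 1 by linarith) hvi
      obtain ⟨o, hoi, ho⟩ : ∃ o, o ≠ i ∧
          ∀ l, l ≠ o → ε ≤ Function.update ν i 0 o - Function.update ν i 0 l := by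
        rcases eq_or_ne i i₀ with rfl | hi₀
        · refine ⟨i₁, hi₁, fun l hl => ?_⟩
          rw [Function.update_of_ne hi₁]
          rcases eq_or_ne l i₀ with rfl | hl₀
          · simp [ν, hi₁]
          · simp [ν, hi₁, hl₀, hl]
        · refine ⟨i₀, hi₀.symm, fun l hl => ?_⟩
          rw [Function.update_of_ne hi₀.symm]
          rcases eq_or_ne l i with rfl | hli
          · simp [ν, two_mul, hε.le]
          · rw [Function.update_of_ne hli]
            simp only [ν, hl, if_true, if_false]
            split_ifs <;> linarith
      obtain ⟨D, o, h1, h2, h3⟩ := π.exists_le_regret_mul_gap hk hν1 hvi1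
        (δ := 9 * ε ^ 2) hε (by positivity)
        (fun l => by
          rcases eq_or_ne l i with rfl | hl
          · rw [Function.update_self]
            nlinarith [hν l]
          · rw [Function.update_of_ne hl, sub_self]
            nlinarith [sq_nonneg ε])
        (B := {i}) (m' := T / 2)
        (fun l hl => (Function.update_of_ne (by simpa using hl) _ _).symm)
        le_rfl hδ (isStoppedEvent_commits (g J) (T / 2) (J * (k - 1) + (k - 1)) i) hi o ho (by
          filter_upwards [hπ.ae_le (gaussian _ hvi1)] with h hsw hcom t ht htT
          rw [Commits.eq_of_le hcom (hsw.trans (by rwa [Nat.succ_mul] at hS)) ht htT]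
          exact hoi.symm)
      refine ⟨D, o, h1, h2, (hfin _ ?_).trans h3⟩
      have h4 : (T : ℝ) ≤ ((T - T / 2 : ℕ) : ℝ) + ((T / 2 : ℕ) : ℝ) := by
        have : T ≤ T - T / 2 + T / 2 := by omega
        exact_mod_cast this
      linarith
  · push Not at hcase
    -- An arm neglected in an early block is raised by `ε ≈ b ^ (-j / 2)`; the block is `b - 1`
    -- times as long as its past, which gives regret times gap of order `b q ^ 2`.
    obtain ⟨j, hj, i, hji⟩ := hcase
    obtain ⟨ε, hε, hεm, hε1⟩ := exists_scale (m := b ^ j) (Nat.one_le_pow _ _ (by omega))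
    have hvi : ∀ l, 0 ≤ Function.update (0 : Fin k → ℝ) i ε l ∧
        Function.update (0 : Fin k → ℝ) i ε l ≤ ε := by
      intro l
      rcases eq_or_ne l i with rfl | hl
      · simp [hε.le]
      · simp [hl, hε.le]
    have hbj : (0 : ℝ) ≤ ((b ^ j : ℕ) : ℝ) := Nat.cast_nonneg _
    obtain ⟨D, o, h1, h2, h3⟩ := π.exists_le_regret_mul_gap hk hu0
      (abs_sub_le_one_of_mem (show ε ≤ 1 by linarith) hvi) (δ := ε ^ 2) hε (by positivity)
      (fun l => by
        simp only [Pi.zero_apply, zero_sub]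
        nlinarith [hvi l]) (B := {i}) (m := b ^ j) (m' := g j) (M := g (j + 1)) (T := T)
      (fun l hl => by
        rw [Set.mem_singleton_iff] at hl
        simp [hl])
      ((hg (show j + 1 ≤ J + 1 by omega)).trans hT) (by nlinarith)
      (isStoppedEvent_avoids (g j) (g (j + 1)) i) hji.le i
      (fun l hl => by simp [hl]) (ae_of_all _ fun h hh => hh)
    refine ⟨D, o, h1, h2, le_trans ?_ h3⟩
    have hlen : ((g (j + 1) - g j : ℕ) : ℝ) = ((b ^ j : ℕ) : ℝ) * (b - 1) := by
      rw [Nat.cast_sub (hg (Nat.le_succ j))]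
      simp only [g]
      push_cast [pow_succ]
      ring
    have hlow : (b : ℝ) / 18 ≤ ε ^ 2 * ((g (j + 1) - g j : ℕ) : ℝ) := by
      rw [hlen, ← mul_assoc]
      have : ε ^ 2 * ((b ^ j : ℕ) : ℝ) = 1 / 9 := by linarith
      rw [this]
      linarith
    calc (b : ℝ) / (67500 * k ^ 2 * ((J + 1 : ℕ) : ℝ) ^ 2) ≤ (b : ℝ) / 18 * (q ^ 2 / 3) := by
          simp only [q]
          rw [div_mul_eq_mul_div, div_le_div_iff₀ (by positivity) (by positivity)]
          field_simp
          norm_num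
      _ ≤ _ := by gcongr

end

end Bandit

/-! ### From the regret lower bound to the number of switches -/

namespace Bandit

variable {k : ℕ}

/-- The grid ratio is `b = ⌊T ^ (1 / N)⌋`; rounding down costs at most a factor `2`. The constants
are explicit in `N`, so `N` may later depend on `T`. -/
theorem UniformRegretBound.rpow_le (hk : 2 ≤ k) {π : ℕ → Policy k} {f : ℕ → ℝ} {C : ℝ} {p : ℕ}
    (h : UniformRegretBound π f C p) {T S N : ℕ} (hN : 1 ≤ N) (hS : S ≤ N * (k - 1))
    (hπ : IsSwitchPolicy (π T) T S) (hT : 2 ≤ T) (hx : 8 ≤ (T : ℝ) ^ (1 / (N : ℝ))) :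
    (T : ℝ) ^ (1 / (N : ℝ)) / (135000 * k ^ 2 * N ^ 2) ≤ C * Real.log T ^ p * f T := by
  set x := (T : ℝ) ^ (1 / (N : ℝ))
  have hx0 : 0 ≤ x := by linarith
  have hk0 : (0 : ℝ) < k := by exact_mod_cast (show 0 < k by omega)
  have hN0 : (0 : ℝ) < N := by exact_mod_cast hN
  have hxN : x ^ N = T := by
    rw [← Real.rpow_natCast, ← Real.rpow_mul (Nat.cast_nonneg T), one_div_mul_cancel hN0.ne',
      Real.rpow_one]
  have hbT : ⌊x⌋₊ ^ N ≤ T := by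
    have : (⌊x⌋₊ : ℝ) ^ N ≤ T := (pow_le_pow_left₀ (Nat.cast_nonneg _) (Nat.floor_le hx0) N).trans
      hxN.le
    exact_mod_cast this
  obtain ⟨D, o, ho, hgap, hreg⟩ :=
    (π T).exists_le_regret_mul_gap_of_isSwitchPolicy hk hN hS hπ (Nat.le_floor hx) hbT
  have h1 := (le_div_iff₀ hgap).1 (h D o ho hgap T hT)
  refine le_trans ?_ (hreg.trans h1)
  have h2 := Nat.lt_floor_add_one x
  calc x / (135000 * k ^ 2 * N ^ 2) = x / 2 / (67500 * k ^ 2 * N ^ 2) := by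
        field_simp
        norm_num
    _ ≤ _ := by
        gcongr
        linarith

theorem UniformlyAchieves.eventually_lt_switches (hk : 2 ≤ k) {N : ℕ} (hN : 1 ≤ N)
    {π : ℕ → Policy k} {S : ℕ → ℕ} (hS : ∀ T, IsSwitchPolicy (π T) T (S T))
    (h : UniformlyAchieves π fun T => (T : ℝ) ^ (1 / ((N : ℝ) + 1))) :
    ∀ᶠ T in atTop, N * (k - 1) + 1 ≤ S T := by
  obtain ⟨C, p, hC⟩ := h
  have hN0 : (0 : ℝ) < N := by exact_mod_cast hN
  have hk0 : (0 : ℝ) < k := by exact_mod_cast (show 0 < k by omega)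
  set K : ℝ := 135000 * k ^ 2 * N ^ 2
  have hK : 0 < K := by positivity
  -- This surplus in the exponent absorbs every power of `log T`.
  have hε : 0 < 1 / (N : ℝ) - 1 / ((N : ℝ) + 1) :=
    sub_pos.2 (one_div_lt_one_div_of_lt hN0 (by linarith))
  have h1 := (isLittleO_log_rpow_rpow_atTop (p : ℝ) hε).bound
    (show 0 < 1 / (2 * K * (|C| + 1)) by positivity)
  have h2 : ∀ᶠ T : ℕ in atTop, 8 ≤ (T : ℝ) ^ (1 / (N : ℝ)) :=
    ((tendsto_rpow_atTop (by positivity)).comp tendsto_natCast_atTop_atTop).eventually_ge_atTop 8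
  filter_upwards [tendsto_natCast_atTop_atTop.eventually h1, h2, eventually_ge_atTop 2] with
    T h1 h2 hT
  by_contra! hlt
  have h3 := hC.rpow_le hk hN (Nat.lt_succ_iff.1 hlt) (hS T) hT h2
  have hT0 : (0 : ℝ) < T := by exact_mod_cast (show 0 < T by omega)
  have hlog : 0 ≤ Real.log T := Real.log_natCast_nonneg T
  rw [Real.rpow_natCast, Real.norm_of_nonneg (by positivity), Real.norm_of_nonneg (by positivity),
    Real.rpow_sub hT0] at h1
  set x := (T : ℝ) ^ (1 / (N : ℝ))
  set y := (T : ℝ) ^ (1 / ((N : ℝ) + 1))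
  have hy : 0 < y := by positivity
  have hx : 0 < x := by positivity
  have h4 : C * Real.log T ^ p * y ≤ x / (2 * K) := by
    calc C * Real.log T ^ p * y ≤ (|C| + 1) * Real.log T ^ p * y := by
          gcongr
          linarith [le_abs_self C]
      _ ≤ (|C| + 1) * (1 / (2 * K * (|C| + 1)) * (x / y)) * y := by gcongr
      _ = x / (2 * K) := by field_simp
  have h5 : x / (2 * K) < x / K := by
    gcongr
    linarith
  linarith

/-- Write `L = log T` and use `rpow_le` with `N = S + 1`. Too few switches force `T ^ (1 / N) ≥ L ^
(p + 4)` and `N ≤ L`; dividing by `N ^ 2` leaves order `L ^ (p + 2)`, against an upper bound `C L ^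
(p + 1)`. -/
theorem UniformRegretBound.eventually_le_switches (hk : 2 ≤ k) {p : ℕ} {π : ℕ → Policy k}
    {S : ℕ → ℕ} {C : ℝ} (hS : ∀ T, IsSwitchPolicy (π T) T (S T))
    (h : UniformRegretBound π (fun T => Real.log T) C p) :
    ∀ᶠ T : ℕ in atTop,
      1 / (2 * ((p : ℝ) + 4)) * (Real.log T / Real.log (Real.log T)) ≤ (S T : ℝ) := by
  have hk0 : (0 : ℝ) < k := by exact_mod_cast (show 0 < k by omega)
  set c : ℝ := 1 / (2 * ((p : ℝ) + 4))
  have hc : 0 < c := by positivity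
  have hlog : Tendsto (fun T : ℕ => Real.log T) atTop atTop :=
    Real.tendsto_log_atTop.comp tendsto_natCast_atTop_atTop
  have h1 := hlog.eventually (Real.isLittleO_log_id_atTop.bound hc)
  filter_upwards [h1, hlog.eventually_ge_atTop 8,
    hlog.eventually_gt_atTop (135000 * k ^ 2 * C), eventually_ge_atTop 2] with T h1 hL8 hLC hT
  by_contra! hlt
  set L := Real.log T
  have hL0 : 0 < L := by linarith
  have hLL : 1 ≤ Real.log L := by
    rw [Real.le_log_iff_exp_le hL0]
    linarith [Real.exp_one_lt_d9]
  rw [Real.norm_of_nonneg (by linarith), id, Real.norm_of_nonneg hL0.le] at h1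
  have hN0 : (0 : ℝ) < ((S T + 1 : ℕ) : ℝ) := by positivity
  have hN : ((S T + 1 : ℕ) : ℝ) * Real.log L ≤ 2 * c * L := by
    rw [← mul_div_assoc, lt_div_iff₀ (by linarith)] at hlt
    push_cast
    linarith
  have h2c : 2 * c * ((p + 4 : ℕ) : ℝ) = 1 := by
    simp only [c]
    push_cast
    field_simp
  have hNL : ((S T + 1 : ℕ) : ℝ) ≤ L := by
    have h3 : 2 * c ≤ 1 := by
      rw [← h2c]
      refine le_mul_of_one_le_right (by positivity) ?_
      exact_mod_cast (by omega : 1 ≤ p + 4)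
    nlinarith
  have hx : L ^ (p + 4) ≤ (T : ℝ) ^ (1 / ((S T + 1 : ℕ) : ℝ)) := by
    have hT0 : (0 : ℝ) < T := by exact_mod_cast (show 0 < T by omega)
    rw [Real.rpow_def_of_pos hT0, ← Real.exp_log (pow_pos hL0 (p + 4)), Real.log_pow,
      Real.exp_le_exp, mul_one_div, le_div_iff₀ hN0]
    calc ((p + 4 : ℕ) : ℝ) * Real.log L * ((S T + 1 : ℕ) : ℝ)
        = ((p + 4 : ℕ) : ℝ) * (((S T + 1 : ℕ) : ℝ) * Real.log L) := by ring
      _ ≤ ((p + 4 : ℕ) : ℝ) * (2 * c * L) := by gcongr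
      _ = L := by linear_combination L * h2c
  have h8 : 8 ≤ L ^ (p + 4) := hL8.trans (le_self_pow₀ (by linarith) (by omega))
  have h3 := h.rpow_le hk (show 1 ≤ S T + 1 by omega)
    ((Nat.le_succ _).trans (Nat.le_mul_of_pos_right _ (by omega))) (hS T) hT (h8.trans hx)
  have h4 : L ^ (p + 4) / (135000 * k ^ 2 * L ^ 2) ≤ C * L ^ p * L :=
    le_trans (by gcongr) h3
  have h5 : L ^ (p + 4) / (135000 * k ^ 2 * L ^ 2) = L ^ (p + 1) * L / (135000 * k ^ 2) := by
    field_simp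
    ring
  rw [h5, div_le_iff₀ (by positivity)] at h4
  have h6 : L ^ (p + 1) * L ≤ L ^ (p + 1) * (135000 * k ^ 2 * C) := by
    calc _ ≤ _ := h4
      _ = _ := by ring
  exact absurd (le_of_mul_le_mul_left h6 (by positivity)) hLC.not_ge

end Bandit

/-! ### Concentration of rewards and reward-driven policies -/

namespace Bandit

noncomputable section

variable {k : ℕ}

/-- The rewards of a history, extended by `0` beyond the last round. -/
def rew {T : ℕ} (h : Fin T → Fin k × ℝ) (t : ℕ) : ℝ := if ht : t < T then (h ⟨t, ht⟩).2 else 0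

theorem measurable_rew {T : ℕ} : Measurable (rew : (Fin T → Fin k × ℝ) → ℕ → ℝ) := by
  refine measurable_pi_lambda _ fun t => ?_
  unfold rew
  split_ifs <;> fun_prop

theorem measurable_act [NeZero k] {T : ℕ} (t : ℕ) :
    Measurable fun h : Fin T → Fin k × ℝ => act h t :=
  measurable_to_countable' fun i => measurableSet_act T fun a => a t = i

theorem act_snoc_of_lt [NeZero k] {T : ℕ} (h : Fin T → Fin k × ℝ) (q : Fin k × ℝ) {t : ℕ}
    (ht : t < T) : act (Fin.snoc h q : Fin (T + 1) → Fin k × ℝ) t = act h t := by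
  simp [act, Fin.snoc, ht, ht.trans (Nat.lt_succ_self T)]

theorem act_snoc_self [NeZero k] {T : ℕ} (h : Fin T → Fin k × ℝ) (q : Fin k × ℝ) :
    act (Fin.snoc h q : Fin (T + 1) → Fin k × ℝ) T = q.1 := by
  simp [act, Fin.snoc]

theorem rew_snoc_of_lt {T : ℕ} (h : Fin T → Fin k × ℝ) (q : Fin k × ℝ) {t : ℕ}
    (ht : t < T) : rew (Fin.snoc h q : Fin (T + 1) → Fin k × ℝ) t = rew h t := by
  simp [rew, Fin.snoc, ht, ht.trans (Nat.lt_succ_self T)]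

theorem rew_snoc_self {T : ℕ} (h : Fin T → Fin k × ℝ) (q : Fin k × ℝ) :
    rew (Fin.snoc h q : Fin (T + 1) → Fin k × ℝ) T = q.2 := by
  simp [rew, Fin.snoc]

/-- The sum, over the rounds of `B`, of the deviations of the rewards from the means of the arms. -/
def noise [NeZero k] (D : Environment k) (B : Finset ℕ) {T : ℕ} (h : Fin T → Fin k × ℝ) : ℝ :=
  ∑ t ∈ B, (rew h t - D.mean (act h t))

theorem measurable_noise [NeZero k] (D : Environment k) (B : Finset ℕ) {T : ℕ} :
    Measurable (noise D B : (Fin T → Fin k × ℝ) → ℝ) := by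
  refine Finset.measurable_sum _ fun t _ => Measurable.sub ?_ ?_
  · exact (measurable_pi_apply t).comp measurable_rew
  · exact (Measurable.of_discrete (f := D.mean)).comp (measurable_act t)

theorem Environment.lintegral_exp_le (D : Environment k) (i : Fin k) (s : ℝ) :
    ∫⁻ x, ENNReal.ofReal (Real.exp (s * (x - D.mean i))) ∂(D.dist i) ≤
      ENNReal.ofReal (Real.exp (s ^ 2 / 2)) := by
  have h : HasSubgaussianMGF (fun x => x - D.mean i) 1 (D.dist i) := D.subGaussian i
  rw [← ofReal_integral_eq_lintegral_ofReal (h.integrable_exp_mul s)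
    (ae_of_all _ fun _ => (Real.exp_pos _).le)]
  refine ENNReal.ofReal_le_ofReal ((h.mgf_le s).trans_eq ?_)
  simp

namespace Policy

/-- Each deviation is centred at the mean of the arm actually played, so conditionally on the past
it is sub-Gaussian however that arm was chosen; each round of `B` contributes a factor `exp (s ^ 2 /
2)`. -/
theorem lintegral_exp_noise_le [NeZero k] (π : Policy k) (D : Environment k) (s : ℝ) (T : ℕ)
    {B : Finset ℕ} (hB : B ⊆ Finset.range T) :
    ∫⁻ h, ENNReal.ofReal (Real.exp (s * noise D B h)) ∂(π.historyLaw D T) ≤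
      ENNReal.ofReal (Real.exp (s ^ 2 / 2 * B.card)) := by
  induction T generalizing B with
  | zero =>
    obtain rfl : B = ∅ := by simpa using hB
    simp [noise]
  | succ T ih =>
    have hm : ∀ {n : ℕ} (B : Finset ℕ), Measurable fun h : Fin n → Fin k × ℝ =>
        ENNReal.ofReal (Real.exp (s * noise D B h)) := fun B =>
      (((measurable_noise D B).const_mul s).exp).ennreal_ofReal
    rw [lintegral_historyLaw_succ π D T (hm B)]
    have hold : ∀ (B' : Finset ℕ) (_ : B' ⊆ Finset.range T) (h : Fin T → Fin k × ℝ) q,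
        noise D B' (Fin.snoc h q : Fin (T + 1) → Fin k × ℝ) = noise D B' h := by
      intro B' hB' h q
      refine Finset.sum_congr rfl fun t ht => ?_
      have htT := Finset.mem_range.1 (hB' ht)
      rw [rew_snoc_of_lt h q htT, act_snoc_of_lt h q htT]
    by_cases hT : T ∈ B
    · have hB' : B.erase T ⊆ Finset.range T := by
        intro t ht
        have h1 := Finset.mem_range.1 (hB (Finset.mem_of_mem_erase ht))
        have h2 := Finset.ne_of_mem_erase ht
        exact Finset.mem_range.2 (by omega)
      have hround : ∀ h, π.roundExp D T (fun h => ENNReal.ofReal (Real.exp (s * noise D B h))) h ≤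
          ENNReal.ofReal (Real.exp (s * noise D (B.erase T) h)) *
            ENNReal.ofReal (Real.exp (s ^ 2 / 2)) := by
        intro h
        have hsplit : ∀ a x, ENNReal.ofReal (Real.exp (s * noise D B
            (Fin.snoc h (a, x) : Fin (T + 1) → Fin k × ℝ))) =
            ENNReal.ofReal (Real.exp (s * noise D (B.erase T) h)) *
              ENNReal.ofReal (Real.exp (s * (x - D.mean a))) := by
          intro a x
          rw [← ENNReal.ofReal_mul (Real.exp_pos _).le, ← Real.exp_add, ← mul_add,
            ← hold _ hB' h (a, x), noise, noise, ← Finset.sum_erase_add _ _ hT, rew_snoc_self,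
            act_snoc_self]
        calc π.roundExp D T (fun h => ENNReal.ofReal (Real.exp (s * noise D B h))) h
            ≤ ∫⁻ _, ENNReal.ofReal (Real.exp (s * noise D (B.erase T) h)) *
                ENNReal.ofReal (Real.exp (s ^ 2 / 2)) ∂(π.kernel T h) := by
              refine lintegral_mono fun a => ?_
              simp only [hsplit]
              rw [lintegral_const_mul _ (by fun_prop)]
              gcongr
              exact D.lintegral_exp_le a s
          _ = _ := by simp
      refine (lintegral_mono hround).trans ?_
      rw [lintegral_mul_const _ (hm _)]
      refine (mul_le_mul_left (ih hB') _).trans_eq ?_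
      rw [← ENNReal.ofReal_mul (Real.exp_pos _).le, ← Real.exp_add, ← Finset.card_erase_add_one hT]
      push_cast
      ring_nf
    · have hB' : B ⊆ Finset.range T := by
        intro t ht
        have h1 := Finset.mem_range.1 (hB ht)
        have h2 : t ≠ T := fun h => hT (h ▸ ht)
        exact Finset.mem_range.2 (by omega)
      refine le_trans (le_of_eq (lintegral_congr fun h => ?_)) (ih hB')
      simp [roundExp, hold B hB']

theorem measureReal_noise_ge_le [NeZero k] (π : Policy k) (D : Environment k) (s w : ℝ) {T : ℕ}
    {B : Finset ℕ} (hB : B ⊆ Finset.range T) :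
    (π.historyLaw D T).real {h | w ≤ s * noise D B h} ≤ Real.exp (s ^ 2 / 2 * B.card - w) := by
  have h1 := mul_meas_ge_le_lintegral (μ := π.historyLaw D T)
    (((measurable_noise D B).const_mul s).exp).ennreal_ofReal (ENNReal.ofReal (Real.exp w))
  have h2 := h1.trans (π.lintegral_exp_noise_le D s T hB)
  have h3 := ENNReal.toReal_mono ENNReal.ofReal_ne_top h2
  rw [ENNReal.toReal_mul, ENNReal.toReal_ofReal (Real.exp_pos _).le,
    ENNReal.toReal_ofReal (Real.exp_pos _).le] at h3
  have h4 : {h : Fin T → Fin k × ℝ | ENNReal.ofReal (Real.exp w) ≤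
      ENNReal.ofReal (Real.exp (s * noise D B h))} = {h | w ≤ s * noise D B h} := by
    ext h
    simp [ENNReal.ofReal_le_ofReal_iff (Real.exp_pos _).le]
  rw [h4] at h3
  rw [Real.exp_sub, le_div_iff₀ (Real.exp_pos _), mul_comm]
  exact h3

/-- Chernoff's bound on both sides, at the optimal exponents `s = ± r`. -/
theorem measureReal_abs_noise_gt_le [NeZero k] (π : Policy k) (D : Environment k) {r : ℝ}
    (hr : 0 ≤ r) {T : ℕ} {B : Finset ℕ} (hB : B ⊆ Finset.range T) :
    (π.historyLaw D T).real {h | B.card * r < |noise D B h|} ≤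
      2 * Real.exp (-(B.card * r ^ 2 / 2)) := by
  have h1 := π.measureReal_noise_ge_le D r (B.card * r ^ 2) hB
  have h2 := π.measureReal_noise_ge_le D (-r) (B.card * r ^ 2) hB
  have h3 : {h : Fin T → Fin k × ℝ | B.card * r < |noise D B h|} ⊆
      {h | B.card * r ^ 2 ≤ r * noise D B h} ∪ {h | B.card * r ^ 2 ≤ -r * noise D B h} := by
    intro h hh
    rcases lt_abs.1 (show B.card * r < |noise D B h| from hh) with hlt | hlt
    · left
      show B.card * r ^ 2 ≤ r * noise D B h
      nlinarith
    · right
      show B.card * r ^ 2 ≤ -r * noise D B h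
      nlinarith
  refine (measureReal_mono h3).trans ((measureReal_union_le _ _).trans ?_)
  have h4 : r ^ 2 / 2 * B.card - B.card * r ^ 2 = -(B.card * r ^ 2 / 2) := by ring
  rw [neg_sq, h4] at h2
  rw [h4] at h1
  linarith

/-- The policy that plays arm `G t x` in round `t`, where `x` is the sequence of past rewards. -/
def ofRewards (G : ℕ → (ℕ → ℝ) → Fin k) (hG : ∀ t, Measurable (G t)) : Policy k where
  kernel t := Kernel.deterministic (fun h => G t (rew h)) ((hG t).comp measurable_rew)
  isMarkov _ := inferInstance

/-- Since `G t` ignores rewards from round `t` on, appending a round does not disturb earlier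
choices. Afterwards the policy can be analysed path by path. -/
theorem ofRewards_ae_act_eq [NeZero k] (G : ℕ → (ℕ → ℝ) → Fin k) (hG : ∀ t, Measurable (G t))
    (hpast : ∀ t x y, (∀ s < t, x s = y s) → G t x = G t y) (D : Environment k) (T : ℕ) :
    ∀ᵐ h ∂((ofRewards G hG).historyLaw D T), ∀ t < T, act h t = G t (rew h) := by
  have hm : ∀ n, MeasurableSet {h : Fin n → Fin k × ℝ | ∀ t < n, act h t = G t (rew h)} := by
    intro n
    have : {h : Fin n → Fin k × ℝ | ∀ t < n, act h t = G t (rew h)} =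
        ⋂ t, ⋂ (_ : t < n), {h | act h t = G t (rew h)} := by
      ext h
      simp
    rw [this]
    exact MeasurableSet.iInter fun t => MeasurableSet.iInter fun _ =>
      measurableSet_eq_fun (measurable_act t) ((hG t).comp measurable_rew)
  induction T with
  | zero => simp
  | succ T ih =>
    rw [ae_iff, ← Set.compl_ofPred, ← lintegral_indicator_one (hm _).compl,
      lintegral_historyLaw_succ _ _ _ (measurable_one.indicator (hm _).compl),
      lintegral_eq_zero_iff (measurable_roundExp _ _ _ (measurable_one.indicator (hm _).compl))]
    filter_upwards [ih] with h hh
    simp only [roundExp, ofRewards, Kernel.deterministic_apply, lintegral_dirac, Pi.zero_apply]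
    refine (lintegral_congr fun x => ?_).trans lintegral_zero
    refine Set.indicator_of_notMem ?_ _
    rw [Set.mem_compl_iff, not_not]
    intro t ht
    have hGt : G t (rew (Fin.snoc h (G T (rew h), x) : Fin (T + 1) → Fin k × ℝ)) = G t (rew h) :=
      hpast t _ _ fun s hs => rew_snoc_of_lt h _ (by omega)
    rcases (Nat.lt_succ_iff.1 ht).lt_or_eq with hlt | rfl
    · rw [hGt, act_snoc_of_lt h _ hlt, hh t hlt]
    · rw [hGt, act_snoc_self]

end Policy

end

end Bandit

/-! ### Schedule, elimination and switch count -/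

namespace Bandit

noncomputable section

variable {k : ℕ}

section Nearest

variable [NeZero k]

/-- The largest arm of `A` that is at most `j`, or the smallest arm of `A` if there is none. -/
def nearest (A : Finset (Fin k)) (j : Fin k) : Fin k :=
  if h : (A.filter (· ≤ j)).Nonempty then (A.filter (· ≤ j)).max' h
  else if h : A.Nonempty then A.min' h else 0

theorem nearest_mem {A : Finset (Fin k)} (hA : A.Nonempty) (j : Fin k) : nearest A j ∈ A := by
  unfold nearest
  split_ifs with h
  · exact (Finset.mem_filter.1 (Finset.max'_mem _ h)).1
  · exact Finset.min'_mem _ _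

theorem nearest_of_mem {A : Finset (Fin k)} {j : Fin k} (hj : j ∈ A) : nearest A j = j := by
  have h : (A.filter (· ≤ j)).Nonempty := ⟨j, Finset.mem_filter.2 ⟨hj, le_rfl⟩⟩
  rw [nearest, dif_pos h]
  exact le_antisymm (Finset.mem_filter.1 (Finset.max'_mem _ h)).2
    (Finset.le_max' (A.filter (· ≤ j)) j (Finset.mem_filter.2 ⟨hj, le_rfl⟩))

/-- Dropping an inactive arm from the range of the maximum changes nothing: its block is played like
that of the arm below it. -/
theorem nearest_eq_of_notMem {A : Finset (Fin k)} {i j : Fin k} (hij : (j : ℕ) = i + 1)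
    (hj : j ∉ A) : nearest A j = nearest A i := by
  have h : A.filter (· ≤ j) = A.filter (· ≤ i) := by
    refine Finset.filter_congr fun a ha => ?_
    have : a ≠ j := fun h => hj (h ▸ ha)
    rw [Fin.le_def, Fin.le_def]
    have := Fin.val_ne_of_ne this
    omega
  simp only [nearest, h]

/-- There is no arm below the bottom one; the fallback to the smallest active arm makes its block
merge with the block above. -/
theorem nearest_zero_eq {A : Finset (Fin k)} {i j : Fin k} (hi : (i : ℕ) = 0) (hj : (j : ℕ) = 1)
    (hiA : i ∉ A) : nearest A i = nearest A j := by
  by_cases hjA : j ∈ A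
  · have h : ¬ (A.filter (· ≤ i)).Nonempty := by
      rintro ⟨a, ha⟩
      rw [Finset.mem_filter, Fin.le_def] at ha
      exact hiA ((Fin.ext (by omega) : a = i) ▸ ha.1)
    rw [nearest_of_mem hjA, nearest, dif_neg h, dif_pos ⟨j, hjA⟩]
    refine le_antisymm (Finset.min'_le _ _ hjA) (Finset.le_min' _ _ _ fun a ha => ?_)
    have : a ≠ i := fun h => hiA (h ▸ ha)
    have := Fin.val_ne_of_ne this
    rw [Fin.le_def]
    omega
  · exact (nearest_eq_of_notMem (by omega) hjA).symm

end Nearest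

/-! ### The schedule

Stage `l` consists of `k` blocks of `n l` rounds, which sweep through the arms upwards for even `l`
and downwards for odd `l`. After `N` stages, the last block goes on forever. -/

section Schedule

/-- The arm to which block `q` belongs. -/
def blockArm (k : ℕ) [NeZero k] (q : ℕ) : Fin k :=
  if Even (q / k) then ⟨q % k, Nat.mod_lt _ (NeZero.pos k)⟩
  else Fin.rev ⟨q % k, Nat.mod_lt _ (NeZero.pos k)⟩

/-- The block of stage `l` that belongs to arm `i`. -/
def blockOf (l : ℕ) (i : Fin k) : ℕ := l * k + if Even l then (i : ℕ) else (Fin.rev i : Fin k)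

theorem blockOf_eq (l : ℕ) (i : Fin k) : ∃ j < k, blockOf l i = l * k + j := by
  unfold blockOf
  split_ifs
  · exact ⟨i, i.2, rfl⟩
  · exact ⟨_, (Fin.rev i).2, rfl⟩

theorem mul_add_div_of_lt [NeZero k] (l : ℕ) {j : ℕ} (hj : j < k) : (l * k + j) / k = l := by
  rw [Nat.add_comm, Nat.add_mul_div_right _ _ (NeZero.pos k), Nat.div_eq_of_lt hj, zero_add]

theorem mul_add_mod_of_lt [NeZero k] (l : ℕ) {j : ℕ} (hj : j < k) : (l * k + j) % k = j := by
  rw [Nat.mul_add_mod', Nat.mod_eq_of_lt hj]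

theorem blockOf_div [NeZero k] (l : ℕ) (i : Fin k) : blockOf l i / k = l := by
  obtain ⟨j, hj, h⟩ := blockOf_eq l i
  rw [h, mul_add_div_of_lt l hj]

theorem blockArm_blockOf [NeZero k] (l : ℕ) (i : Fin k) : blockArm k (blockOf l i) = i := by
  unfold blockArm
  rw [blockOf_div]
  split_ifs with hl
  · ext
    simpa only [blockOf, hl, if_true] using mul_add_mod_of_lt l i.2
  · rw [Fin.rev_eq_iff]
    ext
    simp only [blockOf, hl, if_false]
    exact mul_add_mod_of_lt l (Fin.rev i).2

theorem blockOf_lt (l : ℕ) (i : Fin k) : blockOf l i + 1 ≤ (l + 1) * k := by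
  obtain ⟨j, hj, h⟩ := blockOf_eq l i
  rw [h, Nat.succ_mul]
  omega

/-- The first round of block `q`. -/
def blockStart (k : ℕ) (n : ℕ → ℕ) (q : ℕ) : ℕ := ∑ q' ∈ Finset.range q, n (q' / k)

variable {n : ℕ → ℕ}

theorem blockStart_succ (n : ℕ → ℕ) (q : ℕ) :
    blockStart k n (q + 1) = blockStart k n q + n (q / k) :=
  Finset.sum_range_succ _ _

theorem blockStart_mono (k : ℕ) (n : ℕ → ℕ) : Monotone (blockStart k n) :=
  monotone_nat_of_le_succ fun q => by
    rw [blockStart, blockStart, Finset.sum_range_succ]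
    exact Nat.le_add_right _ _

theorem blockStart_stage [NeZero k] (n : ℕ → ℕ) (l : ℕ) :
    blockStart k n ((l + 1) * k) = blockStart k n (l * k) + k * n l := by
  have h : ∀ j ≤ k, blockStart k n (l * k + j) = blockStart k n (l * k) + j * n l := by
    intro j hj
    induction j with
    | zero => simp
    | succ j ih =>
      rw [← add_assoc, blockStart_succ, ih (by omega), mul_add_div_of_lt l (by omega), Nat.succ_mul]
      omega
  rw [Nat.succ_mul, h k le_rfl]

/-- The block of round `t`. -/
def block (k : ℕ) (n : ℕ → ℕ) (N t : ℕ) : ℕ :=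
  Nat.findGreatest (fun q => blockStart k n q ≤ t) (N * k)

theorem block_le (n : ℕ → ℕ) (N t : ℕ) : block k n N t ≤ N * k := Nat.findGreatest_le _

theorem blockStart_block_le (n : ℕ → ℕ) (N t : ℕ) : blockStart k n (block k n N t) ≤ t :=
  Nat.findGreatest_spec (P := fun q => blockStart k n q ≤ t) (Nat.zero_le _) (by simp [blockStart])

theorem lt_blockStart_block_succ {N t : ℕ} (h : block k n N t < N * k) :
    t < blockStart k n (block k n N t + 1) :=
  not_le.1 (Nat.findGreatest_is_greatest (P := fun q => blockStart k n q ≤ t) (n := N * k)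
    (k := block k n N t + 1) (Nat.lt_succ_self _) h)

theorem block_mono (n : ℕ → ℕ) (N : ℕ) : Monotone (block k n N) := fun _ _ h =>
  Nat.le_findGreatest (block_le n N _) ((blockStart_block_le n N _).trans h)

theorem blockStart_strictMono (hn : ∀ l, 0 < n l) : StrictMono (blockStart k n) :=
  strictMono_nat_of_lt_succ fun q => by
    rw [blockStart_succ]
    exact Nat.lt_add_of_pos_right (hn _)

/-- Blocks of positive length cannot be skipped. -/
theorem block_succ_le (hn : ∀ l, 0 < n l) (N t : ℕ) :
    block k n N (t + 1) ≤ block k n N t + 1 := by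
  by_contra! hlt
  have h1 := block_le (k := k) n N (t + 1)
  have h2 := lt_blockStart_block_succ (k := k) (n := n) (N := N) (t := t) (by omega)
  have h3 := blockStart_strictMono (k := k) hn hlt
  have h4 := blockStart_block_le (k := k) n N (t + 1)
  omega

theorem block_eq {N q t : ℕ} (hq : q < N * k) (h1 : blockStart k n q ≤ t)
    (h2 : t < blockStart k n (q + 1)) : block k n N t = q := by
  refine le_antisymm ?_ (Nat.le_findGreatest hq.le h1)
  by_contra! hlt
  have h3 := blockStart_mono k n (show q + 1 ≤ block k n N t from hlt)
  have h4 := blockStart_block_le (k := k) n N t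
  omega

theorem card_stage_le [NeZero k] (n : ℕ → ℕ) {N l : ℕ} (hl : l < N) (T : ℕ) :
    ((Finset.range T).filter fun t => block k n N t / k = l).card ≤ k * n l := by
  have hk := NeZero.pos k
  calc _ ≤ (Finset.Ico (blockStart k n (l * k)) (blockStart k n ((l + 1) * k))).card := by
        refine Finset.card_le_card fun t ht => ?_
        obtain ⟨-, ht⟩ := Finset.mem_filter.1 ht
        have h1 : l * k ≤ block k n N t := by
          rw [← ht]
          exact Nat.div_mul_le_self _ _
        have h2 : block k n N t < (l + 1) * k := (Nat.div_lt_iff_lt_mul hk).1 (by omega)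
        have h3 : (l + 1) * k ≤ N * k := Nat.mul_le_mul_right k hl
        rw [Finset.mem_Ico]
        exact ⟨(blockStart_mono k n h1).trans (blockStart_block_le n N t),
          (lt_blockStart_block_succ (h2.trans_le h3)).trans_le (blockStart_mono k n h2)⟩
    _ = k * n l := by simp [blockStart_stage]

end Schedule

/-! ### Successive elimination -/

section Elimination

/-- The average reward in the block of stage `l` that belongs to arm `i`. -/
def estimate (n : ℕ → ℕ) (l : ℕ) (i : Fin k) (x : ℕ → ℝ) : ℝ :=
  (∑ t ∈ Finset.Ico (blockStart k n (blockOf l i)) (blockStart k n (blockOf l i + 1)), x t) / n l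

/-- The arms that are still active in stage `l`. -/
def active (n : ℕ → ℕ) (r : ℕ → ℝ) : ℕ → (ℕ → ℝ) → Finset (Fin k)
  | 0, _ => Finset.univ
  | l + 1, x =>
    open scoped Classical in
    (active n r l x).filter fun i => ∀ j ∈ active n r l x,
      estimate n l j x - estimate n l i x ≤ 2 * r l

/-- The arm played in block `q`. -/
def playedArm [NeZero k] (n : ℕ → ℕ) (r : ℕ → ℝ) (q : ℕ) (x : ℕ → ℝ) : Fin k :=
  nearest (active n r (q / k) x) (blockArm k q)

variable {n : ℕ → ℕ} {r : ℕ → ℝ}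

theorem mem_active_succ {l : ℕ} {x : ℕ → ℝ} {i : Fin k} :
    i ∈ active n r (l + 1) x ↔ i ∈ active n r l x ∧ ∀ j ∈ (active n r l x : Finset (Fin k)),
      estimate n l j x - estimate n l i x ≤ 2 * r l := by
  classical
  rw [active, Finset.mem_filter]

/-- The active arm with the best estimate survives. -/
theorem active_nonempty [NeZero k] (hr : ∀ l, 0 ≤ r l) (l : ℕ) (x : ℕ → ℝ) :
    (active n r l x : Finset (Fin k)).Nonempty := by
  induction l with
  | zero => exact ⟨0, Finset.mem_univ _⟩
  | succ l ih =>
    obtain ⟨i, hi, hmax⟩ := Finset.exists_max_image _ (fun i => estimate n l i x) ih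
    refine ⟨i, mem_active_succ.2 ⟨hi, fun j hj => ?_⟩⟩
    linarith [hmax j hj, hr l]

theorem estimate_congr {x y : ℕ → ℝ} {l : ℕ} (i : Fin k)
    (h : ∀ s < blockStart k n ((l + 1) * k), x s = y s) :
    estimate n l i x = estimate n l i y := by
  unfold estimate
  congr 1
  refine Finset.sum_congr rfl fun t ht => h t ?_
  exact (Finset.mem_Ico.1 ht).2.trans_le (blockStart_mono k n (blockOf_lt l i))

theorem active_congr {x y : ℕ → ℝ} {l : ℕ} (h : ∀ s < blockStart k n (l * k), x s = y s) :
    (active n r l x : Finset (Fin k)) = active n r l y := by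
  induction l with
  | zero => rfl
  | succ l ih =>
    have ih := ih fun s hs => h s (hs.trans_le (blockStart_mono k n
      (Nat.mul_le_mul_right k (Nat.le_succ l))))
    ext i
    simp only [mem_active_succ, ih, estimate_congr _ h]

/-- Eliminations use completed stages only, hence rewards from before round `t`. -/
theorem playedArm_block_congr [NeZero k] (n : ℕ → ℕ) (r : ℕ → ℝ) (N t : ℕ) {x y : ℕ → ℝ}
    (h : ∀ s < t, x s = y s) :
    (playedArm n r (block k n N t) x : Fin k) = playedArm n r (block k n N t) y := by
  unfold playedArm
  rw [active_congr fun s hs => h s (hs.trans_le ?_)]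
  exact (blockStart_mono k n (Nat.div_mul_le_self _ _)).trans (blockStart_block_le n N t)

theorem measurable_estimate (n : ℕ → ℕ) (l : ℕ) (i : Fin k) : Measurable (estimate n l i) := by
  unfold estimate
  fun_prop

theorem measurableSet_mem_active (n : ℕ → ℕ) (r : ℕ → ℝ) (l : ℕ) (i : Fin k) :
    MeasurableSet {x | i ∈ active n r l x} := by
  induction l generalizing i with
  | zero => simp [active]
  | succ l ih =>
    simp only [mem_active_succ]
    refine (ih i).inter ?_
    refine measurableSet_setOfPred.2 (Measurable.forall fun j => Measurable.imp
      (measurableSet_setOfPred.1 (ih j)) (measurableSet_setOfPred.1 ?_))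
    exact measurableSet_le ((measurable_estimate n l j).sub (measurable_estimate n l i))
      measurable_const

theorem measurable_playedArm [NeZero k] (n : ℕ → ℕ) (r : ℕ → ℝ) (q : ℕ) :
    Measurable (playedArm n r q : (ℕ → ℝ) → Fin k) := by
  classical
  have h1 : Measurable fun (x : ℕ → ℝ) (i : Fin k) => i ∈ active n r (q / k) x :=
    measurable_pi_lambda _ fun i =>
      measurableSet_setOfPred.1 (measurableSet_mem_active n r (q / k) i)
  -- Encoding the active set as a predicate makes the selection rule a function on a finite discrete
  -- space.
  have h2 : Measurable fun P : Fin k → Prop => nearest (Finset.univ.filter P) (blockArm k q) :=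
    Measurable.of_discrete
  have h3 := h2.comp h1
  have h4 : (playedArm n r q : (ℕ → ℝ) → Fin k) =
      (fun P : Fin k → Prop => nearest (Finset.univ.filter P) (blockArm k q)) ∘
        fun (x : ℕ → ℝ) (i : Fin k) => i ∈ active n r (q / k) x := by
    funext x
    simp [playedArm]
  rw [h4]
  exact h3

/-- Of the switches at the beginning and at the end of the first block of a stage, at most one takes
place. -/
theorem playedArm_eq_or [NeZero k] (hk : 2 ≤ k) (n : ℕ → ℕ) (r : ℕ → ℝ) (l : ℕ) (x : ℕ → ℝ) :
    (playedArm n r ((l + 1) * k - 1) x : Fin k) = playedArm n r ((l + 1) * k) x ∨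
      (playedArm n r ((l + 1) * k) x : Fin k) = playedArm n r ((l + 1) * k + 1) x := by
  have e1 : (l + 1) * k - 1 = l * k + (k - 1) := by
    rw [Nat.succ_mul]
    omega
  have d1 : ((l + 1) * k - 1) / k = l := by rw [e1, mul_add_div_of_lt l (by omega)]
  have m1 : ((l + 1) * k - 1) % k = k - 1 := by rw [e1, mul_add_mod_of_lt l (by omega)]
  have d2 : ((l + 1) * k) / k = l + 1 := Nat.mul_div_cancel _ (by omega)
  have m2 : ((l + 1) * k) % k = 0 := Nat.mul_mod_left _ _
  have d3 : ((l + 1) * k + 1) / k = l + 1 := mul_add_div_of_lt _ (by omega)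
  have m3 : ((l + 1) * k + 1) % k = 1 := mul_add_mod_of_lt _ (by omega)
  -- The sweep reverses direction, so the blocks on both sides of a stage boundary belong to the
  -- same arm.
  have hbd : blockArm k ((l + 1) * k - 1) = blockArm k ((l + 1) * k) := by
    ext
    simp only [blockArm, d1, m1, d2, m2, Nat.even_add_one]
    split_ifs with hl
    · simp [Fin.val_rev]
    · simp [Fin.val_rev]
      omega
  by_cases hmem : blockArm k ((l + 1) * k) ∈ active n r (l + 1) x
  · left
    have hmem' := (mem_active_succ.1 hmem).1
    rw [playedArm, playedArm, hbd, d1, d2, nearest_of_mem hmem, nearest_of_mem hmem']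
  · right
    rw [playedArm, playedArm, d2, d3]
    by_cases hl : Even (l + 1)
    · refine nearest_zero_eq ?_ ?_ hmem
      · simp [blockArm, d2, hl]
      · simp [blockArm, d3, m3, hl]
    · refine nearest_eq_of_notMem ?_ hmem
      simp only [blockArm, d2, d3, m2, m3, hl, if_false, Fin.val_rev]
      omega

/-- The first stage makes at most `k - 1` switches. Each later one has `k` block boundaries, of
which the first two count once by `playedArm_eq_or`. The extra `1` is the passage to the final
block. -/
theorem switchesIn_playedArm_le [NeZero k] (hk : 2 ≤ k) (n : ℕ → ℕ) (r : ℕ → ℝ)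
    {N : ℕ} (hN : 1 ≤ N) (x : ℕ → ℝ) :
    switchesIn (fun q => (playedArm n r q x : Fin k)) 0 (N * k) ≤ N * (k - 1) + 1 := by
  set d : ℕ → Fin k := fun q => playedArm n r q x
  have hcard : ∀ u v, switchesIn d u v ≤ v - u := fun u v =>
    (Finset.card_filter_le _ _).trans (by simp)
  have hmain : ∀ l, switchesIn d 0 ((l + 1) * k - 1) ≤ (l + 1) * (k - 1) := by
    intro l
    induction l with
    | zero => simpa using hcard 0 (k - 1)
    | succ l ih =>
      set q := (l + 1) * k
      have hq : 1 ≤ q := Nat.mul_pos (Nat.succ_pos l) (by omega)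
      have e : (l + 1 + 1) * k - 1 = q + (k - 1) := by
        rw [Nat.succ_mul]
        omega
      have hor : d (q - 1) = d q ∨ d q = d (q + 1) := playedArm_eq_or hk n r l x
      have h1 := switchesIn_add d (Nat.zero_le (q - 1)) (show q - 1 ≤ q + 1 by omega)
      have h2 := switchesIn_add d (Nat.zero_le (q + 1)) (show q + 1 ≤ q + (k - 1) by omega)
      have h3 := hcard (q + 1) (q + (k - 1))
      have h4 := switchesIn_add d (show q - 1 ≤ q by omega) (show q ≤ q + 1 by omega)
      have h5 := switchesIn_succ d (q - 1)
      have h6 := switchesIn_succ d q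
      rw [show q - 1 + 1 = q by omega] at h5
      have h7 : switchesIn d (q - 1) (q + 1) ≤ 1 := by
        rw [← h4, h5, h6]
        rcases hor with h | h
        · simp only [h, ne_eq, not_true_eq_false, if_false]
          split_ifs <;> omega
        · simp only [h, ne_eq, not_true_eq_false, if_false]
          split_ifs <;> omega
      rw [e, Nat.succ_mul]
      omega
  obtain ⟨l, rfl⟩ : ∃ l, N = l + 1 := ⟨N - 1, by omega⟩
  have hq : 1 ≤ (l + 1) * k := Nat.mul_pos (Nat.succ_pos l) (by omega)
  have h1 := switchesIn_add d (Nat.zero_le ((l + 1) * k - 1)) (Nat.sub_le ((l + 1) * k) 1)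
  have h2 := hcard ((l + 1) * k - 1) ((l + 1) * k)
  have h3 := hmain l
  omega

/-- A switch between rounds can only happen where the block changes, and distinct rounds cross
distinct block boundaries. -/
theorem switchesIn_comp_block_le (hn : ∀ l, 0 < n l) {N T : ℕ} {a d : ℕ → Fin k}
    (h : ∀ t < T, a t = d (block k n N t)) :
    switchesIn a 0 (T - 1) ≤ switchesIn d 0 (N * k) := by
  have key : ∀ s ∈ (Finset.Ico 0 (T - 1)).filter fun s => a s ≠ a (s + 1),
      block k n N (s + 1) = block k n N s + 1 ∧
        d (block k n N s) ≠ d (block k n N s + 1) := by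
    intro s hs
    rw [Finset.mem_filter, Finset.mem_Ico] at hs
    have h1 := block_succ_le (k := k) hn N s
    have h2 := block_mono (k := k) n N (Nat.le_succ s)
    have hne := hs.2
    rw [h s (by omega), h (s + 1) (by omega)] at hne
    have h3 : block k n N (s + 1) ≠ block k n N s := fun h => hne (by rw [h])
    have h4 : block k n N (s + 1) = block k n N s + 1 := by
      have : s.succ = s + 1 := rfl
      rw [this] at h2
      omega
    exact ⟨h4, h4 ▸ hne⟩
  refine Finset.card_le_card_of_injOn (block k n N) (fun s hs => ?_) fun s hs s' hs' hss => ?_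
  · obtain ⟨h1, h2⟩ := key s hs
    have h3 := block_le (k := k) n N (s + 1)
    exact Finset.mem_coe.2 (Finset.mem_filter.2 ⟨Finset.mem_Ico.2 ⟨Nat.zero_le _, by omega⟩, h2⟩)
  · have h1 := (key s hs).1
    have h2 := (key s' hs').1
    by_contra hne
    rcases lt_or_gt_of_ne hne with hlt | hlt
    · have := block_mono (k := k) n N (show s + 1 ≤ s' from hlt)
      omega
    · have := block_mono (k := k) n N (show s' + 1 ≤ s from hlt)
      omega

end Elimination

end

end Bandit

/-! ### Regret of successive elimination -/

namespace Bandit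

noncomputable section

variable {k : ℕ} {n : ℕ → ℕ} {r : ℕ → ℝ} {N T : ℕ}

/-- The rewards of every completed block of the first `N` stages are close to their expectation. -/
def Concentrated [NeZero k] (D : Environment k) (n : ℕ → ℕ) (r : ℕ → ℝ) (N : ℕ)
    (h : Fin T → Fin k × ℝ) : Prop :=
  ∀ l < N, ∀ i : Fin k, blockStart k n (blockOf l i + 1) ≤ T →
    |noise D (Finset.Ico (blockStart k n (blockOf l i)) (blockStart k n (blockOf l i + 1))) h| ≤
      n l * r l

theorem Environment.gap_le_one (hk : 2 ≤ k) {D : Environment k} {o : Fin k}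
    (ho : D.IsOptimal o) : D.gap o ≤ 1 := by
  have : Nontrivial (Fin k) := Fin.nontrivial_iff_two_le.2 hk
  obtain ⟨i, hi⟩ := exists_ne o
  exact (ho.gap_le hi).trans ((le_abs_self _).trans (D.mean_sub_le o i))

theorem card_Ico_blockOf [NeZero k] (l : ℕ) (i : Fin k) :
    (Finset.Ico (blockStart k n (blockOf l i)) (blockStart k n (blockOf l i + 1))).card = n l := by
  rw [Nat.card_Ico, blockStart_succ, blockOf_div, Nat.add_sub_cancel_left]

/-- An active arm plays the whole of its own block, so the noise of the block is `n l` times the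
estimation error. -/
theorem Concentrated.abs_estimate_sub_le [NeZero k] {D : Environment k} {h : Fin T → Fin k × ℝ}
    (hh : Concentrated D n r N h) (hn : ∀ l, 0 < n l)
    (hact : ∀ t < T, act h t = playedArm n r (block k n N t) (rew h)) {l : ℕ} (hl : l < N)
    (hlT : blockStart k n ((l + 1) * k) ≤ T) {i : Fin k} (hi : i ∈ active n r l (rew h)) :
    |estimate n l i (rew h) - D.mean i| ≤ r l := by
  have hT := (blockStart_mono k n (blockOf_lt l i)).trans hlT
  have h1 := hh l hl i hT
  have hn' : (0 : ℝ) < n l := by exact_mod_cast hn l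
  have h2 : noise D (Finset.Ico (blockStart k n (blockOf l i))
      (blockStart k n (blockOf l i + 1))) h = n l * (estimate n l i (rew h) - D.mean i) := by
    have h3 : ∀ t ∈ Finset.Ico (blockStart k n (blockOf l i)) (blockStart k n (blockOf l i + 1)),
        rew h t - D.mean (act h t) = rew h t - D.mean i := by
      intro t ht
      obtain ⟨ht1, ht2⟩ := Finset.mem_Ico.1 ht
      have hq : blockOf l i < N * k :=
        (blockOf_lt l i).trans (Nat.mul_le_mul_right k hl)
      rw [hact t (ht2.trans_le hT), block_eq hq ht1 ht2, playedArm, blockOf_div, blockArm_blockOf,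
        nearest_of_mem hi]
    rw [noise, Finset.sum_congr rfl h3, Finset.sum_sub_distrib, Finset.sum_const,
      card_Ico_blockOf, nsmul_eq_mul, mul_sub, estimate, mul_div_cancel₀ _ hn'.ne']
  rw [h2, abs_mul, abs_of_pos hn'] at h1
  exact le_of_mul_le_mul_left h1 hn'

theorem Concentrated.mem_active [NeZero k] {D : Environment k} {h : Fin T → Fin k × ℝ}
    (hh : Concentrated D n r N h) (hn : ∀ l, 0 < n l)
    (hact : ∀ t < T, act h t = playedArm n r (block k n N t) (rew h)) {o : Fin k}
    (ho : D.IsOptimal o) {l : ℕ} (hl : l ≤ N) (hlT : blockStart k n (l * k) ≤ T) :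
    o ∈ active n r l (rew h) := by
  induction l with
  | zero => exact Finset.mem_univ o
  | succ l ih =>
    have hol := ih (by omega) ((blockStart_mono k n
      (Nat.mul_le_mul_right k (Nat.le_succ l))).trans hlT)
    refine mem_active_succ.2 ⟨hol, fun j hj => ?_⟩
    have h1 := abs_le.1 (hh.abs_estimate_sub_le hn hact hl hlT hol)
    have h2 := abs_le.1 (hh.abs_estimate_sub_le hn hact hl hlT hj)
    linarith [ho j]

/-- The optimal arm is still active and is compared with `i`: `2 r` from the test and `r` from each
estimate. -/
theorem Concentrated.mean_sub_le [NeZero k] {D : Environment k} {h : Fin T → Fin k × ℝ}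
    (hh : Concentrated D n r N h) (hn : ∀ l, 0 < n l)
    (hact : ∀ t < T, act h t = playedArm n r (block k n N t) (rew h)) {o : Fin k}
    (ho : D.IsOptimal o) {l : ℕ} (hl : l < N) (hlT : blockStart k n ((l + 1) * k) ≤ T) {i : Fin k}
    (hi : i ∈ active n r (l + 1) (rew h)) : D.mean o - D.mean i ≤ 4 * r l := by
  obtain ⟨hil, hi⟩ := mem_active_succ.1 hi
  have hol := hh.mem_active hn hact ho hl.le ((blockStart_mono k n
    (Nat.mul_le_mul_right k (Nat.le_succ l))).trans hlT)
  have h1 := abs_le.1 (hh.abs_estimate_sub_le hn hact hl hlT hol)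
  have h2 := abs_le.1 (hh.abs_estimate_sub_le hn hact hl hlT hil)
  linarith [hi o hol]

theorem Concentrated.sum_le [NeZero k] {D : Environment k} {h : Fin T → Fin k × ℝ}
    (hh : Concentrated D n r N h) (hn : ∀ l, 0 < n l) (hr : ∀ l, 0 ≤ r l)
    (hact : ∀ t < T, act h t = playedArm n r (block k n N t) (rew h)) {o : Fin k}
    (ho : D.IsOptimal o) (hgap : 0 < D.gap o) {W : ℕ → ℝ} (hW0 : 1 ≤ W 0)
    (hW : ∀ l, 16 * r l ^ 2 / D.gap o ≤ W (l + 1)) :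
    ∑ t ∈ Finset.range T, (D.mean o - D.mean (act h t)) ≤
      ∑ l ∈ Finset.range N, k * n l * W l + T * W N := by
  have hWpos : ∀ l, 0 ≤ W l := by
    intro l
    cases l with
    | zero => linarith
    | succ l => exact le_trans (by positivity) (hW l)
  have hpt : ∀ t < T, D.mean o - D.mean (act h t) ≤ W (block k n N t / k) := by
    intro t ht
    have hq : blockStart k n (block k n N t / k * k) ≤ T :=
      ((blockStart_mono k n (Nat.div_mul_le_self _ _)).trans (blockStart_block_le n N t)).trans ht.le
    have hlN : block k n N t / k ≤ N := Nat.div_le_of_le_mul (by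
      rw [mul_comm]
      exact block_le n N t)
    have hmem : act h t ∈ active n r (block k n N t / k) (rew h) := by
      rw [hact t ht]
      exact nearest_mem (active_nonempty hr _ _) _
    cases hl : block k n N t / k with
    | zero => exact ((le_abs_self _).trans (D.mean_sub_le o _)).trans hW0
    | succ l =>
      rw [hl] at hq hlN hmem
      have h1 := hh.mean_sub_le hn hact ho hlN hq hmem
      -- A loss `x` that is `0` or lies in `[Δ, 4 r]` satisfies `x Δ ≤ x ^ 2 ≤ 16 r ^ 2`.
      refine le_trans ?_ (hW l)
      rw [le_div_iff₀ hgap]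
      rcases eq_or_ne (act h t) o with heq | hne
      · rw [heq, sub_self, zero_mul]
        positivity
      · have h2 := ho.gap_le hne
        nlinarith
  calc ∑ t ∈ Finset.range T, (D.mean o - D.mean (act h t))
      ≤ ∑ t ∈ Finset.range T, W (block k n N t / k) :=
        Finset.sum_le_sum fun t ht => hpt t (Finset.mem_range.1 ht)
    _ = ∑ l ∈ Finset.range (N + 1), ∑ t ∈ Finset.range T with block k n N t / k = l,
          W (block k n N t / k) := by
        refine (Finset.sum_fiberwise_of_maps_to (fun t _ => ?_) _).symm
        rw [Finset.mem_range, Nat.lt_succ_iff]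
        refine Nat.div_le_of_le_mul ?_
        rw [mul_comm]
        exact block_le n N t
    _ = ∑ l ∈ Finset.range (N + 1),
          (((Finset.range T).filter fun t => block k n N t / k = l).card : ℝ) * W l := by
        refine Finset.sum_congr rfl fun l _ => ?_
        rw [Finset.sum_congr rfl fun t ht => by rw [(Finset.mem_filter.1 ht).2], Finset.sum_const,
          nsmul_eq_mul]
    _ ≤ _ := by
        rw [Finset.sum_range_succ]
        refine add_le_add (Finset.sum_le_sum fun l hl => ?_) ?_
        · refine mul_le_mul_of_nonneg_right ?_ (hWpos l)
          exact_mod_cast card_stage_le n (Finset.mem_range.1 hl) T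
        · refine mul_le_mul_of_nonneg_right ?_ (hWpos N)
          exact_mod_cast (Finset.card_filter_le _ _).trans (Finset.card_range T).le

theorem Policy.measureReal_not_concentrated_le [NeZero k] (π : Policy k) (D : Environment k)
    (n : ℕ → ℕ) (hr : ∀ l, 0 ≤ r l) (N T : ℕ) {e : ℝ}
    (he : ∀ l, Real.exp (-(n l * r l ^ 2 / 2)) ≤ e) :
    (π.historyLaw D T).real {h | ¬ Concentrated D n r N h} ≤ N * k * (2 * e) := by
  have he0 : 0 ≤ e := (Real.exp_pos _).le.trans (he 0)
  set B : ℕ × Fin k → Finset ℕ := fun x =>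
    Finset.Ico (blockStart k n (blockOf x.1 x.2)) (blockStart k n (blockOf x.1 x.2 + 1))
  have h1 : {h : Fin T → Fin k × ℝ | ¬ Concentrated D n r N h} ⊆
      -- Blocks running past the horizon are never tested, so their events are made empty.
      ⋃ x ∈ Finset.range N ×ˢ (Finset.univ : Finset (Fin k)),
        {h | B x ⊆ Finset.range T ∧ (B x).card * r x.1 < |noise D (B x) h|} := by
    intro h hh
    simp only [Concentrated, Set.mem_ofPred_eq, not_forall, not_le] at hh
    obtain ⟨l, hl, i, hi, hh⟩ := hh
    simp only [Set.mem_iUnion, Finset.mem_product, Finset.mem_range, Finset.mem_univ]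
    refine ⟨(l, i), ⟨hl, trivial⟩, fun t ht => ?_, ?_⟩
    · exact Finset.mem_range.2 ((Finset.mem_Ico.1 ht).2.trans_le hi)
    · simp only [B, card_Ico_blockOf]
      exact hh
  refine (measureReal_mono h1 (measure_ne_top _ _)).trans
    ((measureReal_biUnion_finset_le _ _).trans ?_)
  refine (Finset.sum_le_card_nsmul _ _ (2 * e) fun x _ => ?_).trans ?_
  · by_cases hx : B x ⊆ Finset.range T
    · refine le_trans (measureReal_mono (fun h hh => hh.2)) ?_
      refine (π.measureReal_abs_noise_gt_le D (hr x.1) hx).trans ?_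
      simp only [B, card_Ico_blockOf]
      linarith [he x.1]
    · simp only [hx, false_and]
      simpa using he0
  · simp [Finset.card_product]

/-- The successive elimination policy with `N` stages of blocks of `n l` rounds and confidence radii
`r l`. -/
def eliminationPolicy (k : ℕ) [NeZero k] (n : ℕ → ℕ) (r : ℕ → ℝ) (N : ℕ) : Policy k :=
  Policy.ofRewards (fun t => playedArm n r (block k n N t)) fun _ => measurable_playedArm n r _

theorem eliminationPolicy_ae [NeZero k] (D : Environment k) (n : ℕ → ℕ) (r : ℕ → ℝ) (N T : ℕ) :
    ∀ᵐ h ∂((eliminationPolicy k n r N).historyLaw D T),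
      ∀ t < T, act h t = playedArm n r (block k n N t) (rew h) :=
  Policy.ofRewards_ae_act_eq _ _ (fun t _ _ h => playedArm_block_congr n r N t h) D T

theorem isSwitchPolicy_eliminationPolicy [NeZero k] (hk : 2 ≤ k) (hn : ∀ l, 0 < n l) (r : ℕ → ℝ)
    (hN : 1 ≤ N) (T : ℕ) : IsSwitchPolicy (eliminationPolicy k n r N) T (N * (k - 1) + 1) := by
  intro D
  simp only [numSwitches_eq]
  rw [← mem_ae_iff_prob_eq_one (measurableSet_act (k := k) T fun a => switchesIn a 0 (T - 1) ≤
    N * (k - 1) + 1)]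
  filter_upwards [eliminationPolicy_ae D n r N T] with h hh
  exact (switchesIn_comp_block_le hn (d := fun q => playedArm n r q (rew h)) hh).trans
    (switchesIn_playedArm_le hk n r hN (rew h))

/-- Off the concentration event the regret is bounded trivially by `T`, since means differ by at
most `1`. -/
theorem regret_eliminationPolicy_le [NeZero k] (hn : ∀ l, 0 < n l) (hr : ∀ l, 0 ≤ r l)
    {D : Environment k} {o : Fin k} (ho : D.IsOptimal o) (hgap : 0 < D.gap o) {W : ℕ → ℝ}
    (hW0 : 1 ≤ W 0) (hW : ∀ l, 16 * r l ^ 2 / D.gap o ≤ W (l + 1)) {e : ℝ}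
    (he : ∀ l, Real.exp (-(n l * r l ^ 2 / 2)) ≤ e) (N T : ℕ) :
    (eliminationPolicy k n r N).regret D T ≤
      ∑ l ∈ Finset.range N, k * n l * W l + T * W N + T * (N * k * (2 * e)) := by
  classical
  set π := eliminationPolicy k n r N
  have hmc : MeasurableSet {h : Fin T → Fin k × ℝ | Concentrated D n r N h} := by
    have : {h : Fin T → Fin k × ℝ | Concentrated D n r N h} =
        ⋂ l, ⋂ (_ : l < N), ⋂ i : Fin k, ⋂ (_ : blockStart k n (blockOf l i + 1) ≤ T),
          {h | |noise D (Finset.Ico (blockStart k n (blockOf l i))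
            (blockStart k n (blockOf l i + 1))) h| ≤ n l * r l} := by
      ext h
      simp [Concentrated]
    rw [this]
    exact MeasurableSet.iInter fun l => MeasurableSet.iInter fun _ => MeasurableSet.iInter fun i =>
      MeasurableSet.iInter fun _ =>
        measurableSet_le (continuous_abs.measurable.comp (measurable_noise D _)) measurable_const
  have hm : MeasurableSet {h : Fin T → Fin k × ℝ | ¬ Concentrated D n r N h} := hmc.compl
  set X := ∑ l ∈ Finset.range N, k * n l * W l + T * W N
  have hX : 0 ≤ X := by
    have hWpos : ∀ l, 0 ≤ W l := by
      intro l
      cases l with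
      | zero => linarith
      | succ l => exact le_trans (by positivity) (hW l)
    exact add_nonneg (Finset.sum_nonneg fun l _ => mul_nonneg (by positivity) (hWpos l))
      (mul_nonneg (by positivity) (hWpos N))
  rw [Policy.regret_eq π ho]
  have hind : Integrable (Set.indicator {h : Fin T → Fin k × ℝ | ¬ Concentrated D n r N h}
      fun _ => (T : ℝ)) (π.historyLaw D T) := (integrable_const _).indicator hm
  calc ∫ h, ∑ t ∈ Finset.range T, (D.mean o - D.mean (act h t)) ∂(π.historyLaw D T)
      ≤ ∫ h, (X + Set.indicator {h : Fin T → Fin k × ℝ | ¬ Concentrated D n r N h}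
          (fun _ => (T : ℝ)) h) ∂(π.historyLaw D T) := by
        refine integral_mono_ae (Policy.integrable_sum_act T _ fun i => D.mean o - D.mean i)
          ((integrable_const _).add hind) ?_
        filter_upwards [eliminationPolicy_ae D n r N T] with h hh
        by_cases hc : Concentrated D n r N h
        · rw [Set.indicator_of_notMem (by simpa using hc), add_zero]
          exact hc.sum_le hn hr hh ho hgap hW0 hW
        · rw [Set.indicator_of_mem (by exact hc)]
          refine le_trans ?_ (le_add_of_nonneg_left hX)
          refine (Finset.sum_le_card_nsmul _ _ 1 fun t _ => ?_).trans (by simp)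
          exact (le_abs_self _).trans (D.mean_sub_le o _)
    _ = X + T * (π.historyLaw D T).real {h | ¬ Concentrated D n r N h} := by
        rw [integral_add (integrable_const _) hind, integral_indicator_const _ hm]
        simp [mul_comm]
    _ ≤ _ := by
        gcongr
        exact π.measureReal_not_concentrated_le D n hr N T he

theorem exists_uniformlyAchieves (hk : 2 ≤ k) (hN : 1 ≤ N) :
    ∃ π : ℕ → Policy k, (∀ T, IsSwitchPolicy (π T) T (N * (k - 1) + 1)) ∧
      UniformlyAchieves π fun T => (T : ℝ) ^ (1 / ((N : ℝ) + 1)) := by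
  have : NeZero k := ⟨by omega⟩
  -- Rounding up ensures `T ≤ b ^ (N + 1)`, needed for the final block, while still `b ≤ 2 x`.
  set b : ℕ → ℕ := fun T => ⌊(T : ℝ) ^ (1 / ((N : ℝ) + 1))⌋₊ + 1
  set r : ℕ → ℕ → ℝ := fun T l => √(2 * Real.log T / (b T : ℝ) ^ (l + 1))
  have hn : ∀ T l, 0 < b T ^ (l + 1) := fun T l => Nat.pow_pos (Nat.succ_pos _)
  refine ⟨fun T => eliminationPolicy k (fun l => b T ^ (l + 1)) (r T) N, fun T =>
    isSwitchPolicy_eliminationPolicy hk (hn T) _ hN T, 136 * N * k, 1, ?_⟩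
  intro D o ho hgap T hT
  have hgap1 := Environment.gap_le_one hk ho
  set Δ := D.gap o
  have hT2 : (2 : ℝ) ≤ T := by exact_mod_cast hT
  set L := Real.log T
  have hL : 1 ≤ 2 * L := by
    have := Real.log_le_log (by norm_num) hT2
    linarith [Real.log_two_gt_d9]
  set x := (T : ℝ) ^ (1 / ((N : ℝ) + 1))
  have hx : 1 ≤ x := Real.one_le_rpow (by linarith) (by positivity)
  have hxb : x < b T := by
    simp only [b]
    push_cast
    exact Nat.lt_floor_add_one x
  have hbx : (b T : ℝ) ≤ 2 * x := by
    simp only [b]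
    push_cast
    linarith [Nat.floor_le (by linarith : 0 ≤ x)]
  have hb0 : (0 : ℝ) < b T := by linarith
  have hTb : (T : ℝ) ≤ (b T : ℝ) ^ (N + 1) := by
    have : x ^ (N + 1) = T := by
      rw [← Real.rpow_natCast, ← Real.rpow_mul (Nat.cast_nonneg T)]
      push_cast
      rw [one_div_mul_cancel (by positivity), Real.rpow_one]
    rw [← this]
    gcongr
  have hr2 : ∀ l, r T l ^ 2 = 2 * L / (b T : ℝ) ^ (l + 1) := fun l =>
    Real.sq_sqrt (div_nonneg (by linarith) (by positivity))
  set W : ℕ → ℝ := fun l => if l = 0 then 1 else 32 * L / ((b T : ℝ) ^ l * Δ)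
  -- The radii are chosen to make the exponent exactly `-log T` in every stage.
  have he : ∀ l, Real.exp (-((b T ^ (l + 1) : ℕ) * r T l ^ 2 / 2)) ≤ 1 / T := by
    intro l
    rw [hr2, Nat.cast_pow, mul_div_cancel₀ _ (by positivity), mul_div_cancel_left₀ _ two_ne_zero,
      Real.exp_neg, Real.exp_log (by linarith), one_div]
  have hreg := regret_eliminationPolicy_le (N := N) (T := T) (hn T) (fun l => Real.sqrt_nonneg _)
    ho hgap (W := W) (by simp [W]) (fun l => by
      rw [hr2]
      simp only [W, Nat.succ_ne_zero, if_false]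
      rw [div_mul_eq_div_div]
      refine le_of_eq ?_
      ring) he
  have hN1 : (1 : ℝ) ≤ N := by exact_mod_cast hN
  have hk1 : (1 : ℝ) ≤ k := by exact_mod_cast (show 1 ≤ k by omega)
  -- Block length `b ^ (l + 1)` against loss of order `log T / (b ^ l Δ)`: each later stage costs a
  -- single factor `b`. Stage `0` has trivial loss and uses `Δ ≤ 1`.
  have hst : ∀ l ∈ Finset.range N, k * ((b T ^ (l + 1) : ℕ) : ℝ) * W l ≤ 32 * 2 * k * x * L / Δ := by
    intro l _
    rw [le_div_iff₀ hgap]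
    by_cases hl : l = 0
    · subst hl
      simp only [W, if_true, zero_add, pow_one, mul_one]
      calc k * (b T : ℝ) * Δ ≤ k * (2 * x) * 1 := by gcongr
        _ ≤ k * (2 * x) * (2 * L) := by gcongr
        _ ≤ 32 * 2 * k * x * L := by
          have : 0 ≤ k * x * L := by positivity
          linarith
    · simp only [W, hl, if_false]
      push_cast
      calc (k : ℝ) * (b T : ℝ) ^ (l + 1) * (32 * L / ((b T : ℝ) ^ l * Δ)) * Δ
          = 32 * k * b T * L := by
            field_simp
            ring
        _ ≤ 32 * k * (2 * x) * L := by gcongr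
        _ = _ := by ring
  have hlast : T * W N ≤ 32 * 2 * x * L / Δ := by
    simp only [W, show N ≠ 0 by omega, if_false]
    calc (T : ℝ) * (32 * L / ((b T : ℝ) ^ N * Δ))
        ≤ (b T : ℝ) ^ (N + 1) * (32 * L / ((b T : ℝ) ^ N * Δ)) := by
          have : 0 ≤ 32 * L / ((b T : ℝ) ^ N * Δ) := div_nonneg (by linarith) (by positivity)
          gcongr
      _ = 32 * b T * L / Δ := by
        field_simp
        ring
      _ ≤ 32 * (2 * x) * L / Δ := by gcongr
      _ = _ := by ring
  have hsum := Finset.sum_le_sum hst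
  rw [Finset.sum_const, Finset.card_range, nsmul_eq_mul] at hsum
  have hbad : (T : ℝ) * (N * k * (2 * (1 / T))) ≤ 4 * N * k * x * L / Δ := by
    rw [le_div_iff₀ hgap]
    calc (T : ℝ) * (N * k * (2 * (1 / T))) * Δ = 2 * N * k * Δ := by field_simp
      _ ≤ 2 * N * k * (x * (2 * L)) := by
        gcongr
        nlinarith
      _ = _ := by ring
  refine hreg.trans ((add_le_add (add_le_add hsum hlast) hbad).trans ?_)
  rw [pow_one]
  have hNk : (1 : ℝ) ≤ N * k := one_le_mul_of_one_le_of_one_le hN1 hk1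
  have hpos : 0 ≤ x * L := mul_nonneg (by linarith) (by linarith)
  calc _ = (64 * (N * k) + 64 * 1 + 4 * (N * k)) * (x * L) / Δ := by ring
    _ ≤ (64 * (N * k) + 64 * (N * k) + 4 * (N * k)) * (x * L) / Δ := by gcongr
    _ ≤ (136 * N * k) * L * x / Δ := by
      gcongr ?_ / Δ
      nlinarith

end

end Bandit

theorem corollary3 (k : ℕ) (hk : 2 ≤ k) :
    -- `N (k - 1) + 1` switches are sufficient and necessary for `Õ(T ^ (1 / (N + 1)) / Δ)`
    (∀ N : ℕ, 1 ≤ N →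
      (∃ π : ℕ → Bandit.Policy k,
        (∀ T, Bandit.IsSwitchPolicy (π T) T (N * (k - 1) + 1)) ∧
        Bandit.UniformlyAchieves π (fun T => (T : ℝ) ^ (1 / ((N : ℝ) + 1)))) ∧
      (∀ (π : ℕ → Bandit.Policy k) (S : ℕ → ℕ),
        (∀ T, Bandit.IsSwitchPolicy (π T) T (S T)) →
        Bandit.UniformlyAchieves π (fun T => (T : ℝ) ^ (1 / ((N : ℝ) + 1))) →
        ∀ᶠ T in Filter.atTop, N * (k - 1) + 1 ≤ S T)) ∧
    -- `Ω(log T / log log T)` switches are necessary for `Õ(log T / Δ)`; the constant `c` depends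
    -- only on `k` and the hidden power `p` of `log T`
    (∀ p : ℕ, ∃ c : ℝ, 0 < c ∧
      ∀ (π : ℕ → Bandit.Policy k) (S : ℕ → ℕ) (C : ℝ),
        (∀ T, Bandit.IsSwitchPolicy (π T) T (S T)) →
        Bandit.UniformRegretBound π (fun T => Real.log T) C p →
        ∀ᶠ T : ℕ in Filter.atTop,
          c * (Real.log T / Real.log (Real.log T)) ≤ (S T : ℝ)) :=
  ⟨fun _ hN => ⟨Bandit.exists_uniformlyAchieves hk hN,
    fun _ _ hS h => h.eventually_lt_switches hk hN hS⟩,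
    fun p => ⟨1 / (2 * ((p : ℝ) + 4)), by positivity,
      fun _ _ _ hS h => h.eventually_le_switches hk hS⟩⟩
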